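/- Let $H$ be a commutative ring (for instance $\mathbb Z$ or $\mathbb Z_2$). **Based matrices.** A based matrix $T=(G,s,b)$ consists of a finite set $G$, an element $s\in G$ and a map $b\colon G\times G\to H$ with $b(h,g)=-b(g,h)$; put $G^\circ=G\setminus\{s\}$ and $b(g,\chi_X)=\sum_{x\in X}b(g,x)$. An element $g\in G^\circ$ is annihilating if $b(g,\cdot)=0$ and core if $b(g,\cdot)=b(s,\cdot)$; two distinct elements $g,g'\in G^\circ$ are complementary if $b(g,\cdot)+b(g',\cdot)=b(s,\cdot)$. The operations $M_1,M_2,M_3$ extend $T$ by one annihilating element, by one core element, by a pair of complementary elements; $T$ and $T'$ are homologous if a chain of these operations and their inverses leads from $T$ to $T'$. $T$ is primitive if it has no annihilating, core or complementary elements. For a partition $\mathfrak C$ of $G$ with $\{s\}\in\mathfrak C$ let $Ann(\mathfrak C)$ be the group of all $v\in\mathbb Z[G^\circ]$ for which there is $k\in\mathbb Z$ with $b(v,\chi_C)=k\,b(s,\chi_C)$ for all $C\in\mathfrak C$. The derived partition $A\mathfrak C$ consists of $\{s\}$ and of the classes of the relation "$g_1-g_2\in Ann(\mathfrak C)$ or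 $g_1+g_2\in Ann(\mathfrak C)$" on $G^\circ$. The stable partition $\mathfrak C_\infty(T)$ is the limit of $A^n\mathfrak C_0$, where $\mathfrak C_0$ is the partition into singletons; its classes are called tribes. The zero tribe $C_0(T)$ (possibly empty) is the intersection with $G$ of the tribe of $g'$ in the based matrix obtained from $T$ by adding an annihilating element $g'$. Under an operation $T\to T'$ a tribe $C'$ of $T'$ corresponds to the tribe $C'\cap G$ of $T$. Let $T_\bullet$ be primitive. Let $\bar{\mathfrak C}(T_\bullet)$ be the finest partition coarser than $\mathfrak C_\infty(T_\bullet)$ each of whose classes is invariant under all automorphisms of $T_\bullet$, let $\bar{\mathfrak C}^*(T_\bullet)$ be the set of its classes that do not contain elements of $C_0(T_\bullet)$, and let $\bar A^{st}(T_\bullet)=H[\bar{\mathfrak C}^*(T_\bullet)]/\langle\bar b(s)\rangle$ with $\bar b(s)=\sum_{C}b(s,\chi_C)\,C$. If $f$ is a chain of operations from $T=(G,s,b)$ to $T_\bullet$, let $f^*C\subset G$ be the union of the tribes of $T$ that correspond under $f$ to the tribes contained in the class $C$. The reduced stable parity of $g\in G$ is $$\bar p^{st}_T(g)=\sum_{C\in\bar{\mathfrak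 C}^*(T_\bullet)}\Bigl(b(g,\chi_{f^*C})-\Bigl\lfloor\frac{|f^*C|}2\Bigr\rfloor b(g,s)\Bigr)\,C\in\bar A^{st}(T_\bullet).$$ **Diagrams.** Let $\mathcal K$ be an oriented virtual or flat knot, and consider its diagrams up to isotopy and detour moves (that is, Gauss diagrams). Let $\mathcal V(D)$ be the set of classical crossings of $D$. The based matrix $T(D)$ has $G=\mathcal V(D)\sqcup\{s\}$, $b(c,c')=D^l_c\cdot D^l_{c'}$, $b(c,s)=D^l_c\cdot D$, $b(s,s)=0$, where $D^l_c$ is the left half of $D$ at $c$ (leaving $c$ along the left outgoing edge) and the dot is the intersection number with values in $H$ in the surface of the diagram. A parity on the diagrams of $\mathcal K$ with coefficients in an abelian group $A$ is a family of maps $p_D\colon\mathcal V(D)\to A$ such that isotopies and Reidemeister moves do not change the value of any surviving crossing and the sum of the values of the crossings participating in a Reidemeister move is zero. For an oriented parity, the last sum is taken, in a third Reidemeister move, with the signs $\varepsilon(c)=\pm1$, where $\varepsilon(c)=1$ if and only if the two sides of the triangle at $c$ are oriented coherently along its boundary (so that for a coherently oriented triangle it is the ordinary sum). **Proposition.** 1.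 There is a primitive based matrix $T_\bullet$ homologous to $T(D)$ for some diagram $D$ of $\mathcal K$. It is unique up to isomorphism, independently of $D$, and so is the group $\bar A^{st}(\mathcal K)=\bar A^{st}(T_\bullet)$. 2. For each such $T_\bullet$, the based matrix of every diagram $D$ of $\mathcal K$ is homologous to $T_\bullet$. For every chain $f$ from $T(D)$ to $T_\bullet$ one has $b_D(s,\chi_{f^*C})=b_\bullet(s,\chi_C)$ for all $C\in\bar{\mathfrak C}^*(T_\bullet)$, and the maps $\bar p^{st}_{T(D)}\colon\mathcal V(D)\to\bar A^{st}(\mathcal K)$ do not depend on the choice of the chains. 3. The family $\bar p^{st}_{T(D)}$ is an oriented parity on the diagrams of $\mathcal K$ with coefficients in $\bar A^{st}(\mathcal K)$. If $2=0$ in $H$, in particular for $H=\mathbb Z_2$, it is a parity. 4. This parity is new: for $H=\mathbb Z_2$ there is a virtual knot with a diagram that has two crossings of the same Gaussian parity but with different values of $\bar p^{st}$. (The Gaussian parity of $c$ is the number modulo 2 of passages through classical crossings in the interior of a half of the diagram at $c$.) -/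

import Mathlib

noncomputable section

namespace KnotParity

/-! ## Based matrices and their homology -/

/-- A based matrix with coefficients in an abelian group `H`: a finite set `G`, a base element `s`
and a skew-symmetric map `b : G × G → H`. -/
structure BasedMatrix.{u} (H : Type u) [AddCommGroup H] where
  G : Type
  [fintypeG : Fintype G]
  s : G
  b : G → G → H
  skew : ∀ g h, b h g = -b g h

attribute [instance] BasedMatrix.fintypeG

namespace BasedMatrix

universe u
variable {H : Type u} [AddCommGroup H]

/-- Isomorphisms of based matrices. The automorphism group of `T` is `Iso T T`. -/
structure Iso (T T' : BasedMatrix H) where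
  toEquiv : T.G ≃ T'.G
  map_s : toEquiv T.s = T'.s
  map_b : ∀ g h, T'.b (toEquiv g) (toEquiv h) = T.b g h

def Annihilating (T : BasedMatrix H) (g : T.G) : Prop :=
  g ≠ T.s ∧ ∀ h, T.b g h = 0

def Core (T : BasedMatrix H) (g : T.G) : Prop :=
  g ≠ T.s ∧ ∀ h, T.b g h = T.b T.s h

/-- Two distinct elements of `G° = G ∖ {s}` whose rows add up to the row of `s`. -/
def Complementary (T : BasedMatrix H) (g g' : T.G) : Prop :=
  g ≠ T.s ∧ g' ≠ T.s ∧ g ≠ g' ∧ ∀ h, T.b g h + T.b g' h = T.b T.s h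

def IsPrimitive (T : BasedMatrix H) : Prop :=
  (∀ g, ¬ T.Annihilating g) ∧ (∀ g, ¬ T.Core g) ∧ ∀ g g', ¬ T.Complementary g g'

/-- An operation `M₁`, `M₂` or `M₃` leading from `T` to `T'`: the matrix `T'` extends `T` along the
inclusion `ι`, and the new elements are one annihilating element, one core element, or a pair of
complementary elements. -/
structure Op (T T' : BasedMatrix H) where
  ι : T.G ↪ T'.G
  map_s : ι T.s = T'.s
  map_b : ∀ g h, T'.b (ι g) (ι h) = T.b g h
  new_elements :
    (∃ g, T'.Annihilating g ∧ ∀ x, x ∉ Set.range ι ↔ x = g) ∨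
    (∃ g, T'.Core g ∧ ∀ x, x ∉ Set.range ι ↔ x = g) ∨
    (∃ g g', T'.Complementary g g' ∧ ∀ x, x ∉ Set.range ι ↔ (x = g ∨ x = g'))

/-- A chain of operations `M₁, M₂, M₃` and of their inverses leading from one based matrix to
another. -/
inductive Chain : BasedMatrix H → BasedMatrix H → Type (max 1 u)
  | refl (T : BasedMatrix H) : Chain T T
  | up {T T₁ T' : BasedMatrix H} (m : Op T T₁) (f : Chain T₁ T') : Chain T T'
  | down {T T₁ T' : BasedMatrix H} (m : Op T₁ T) (f : Chain T₁ T') : Chain T T'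

/-- Two based matrices are homologous if they are connected by a chain of operations. -/
def Homologous (T T' : BasedMatrix H) : Prop := Nonempty (Chain T T')

/-! ## The stable partition

Partitions of `G` are represented by equivalence relations. -/

/-- `b (g, χ_X)`, the sum of `b (g, x)` over `x ∈ X`. -/
def rowSum (T : BasedMatrix H) (g : T.G) (X : Set T.G) : H :=
  ∑ x, X.indicator (T.b g) x

/-- The set `G° = G ∖ {s}`; the group `ℤ[G°]` is `T.Circ → ℤ`. -/
abbrev Circ (T : BasedMatrix H) : Type := {g : T.G // g ≠ T.s}

/-- `b (v, χ_X)` for `v ∈ ℤ[G°]`. -/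
def linSum (T : BasedMatrix H) (v : T.Circ → ℤ) (X : Set T.G) : H :=
  open Classical in ∑ g : T.Circ, v g • T.rowSum g X

lemma linSum_add (T : BasedMatrix H) (v w : T.Circ → ℤ) (X : Set T.G) :
    T.linSum (v + w) X = T.linSum v X + T.linSum w X := by
  simp [linSum, add_smul, Finset.sum_add_distrib]

lemma linSum_neg (T : BasedMatrix H) (v : T.Circ → ℤ) (X : Set T.G) :
    T.linSum (-v) X = -T.linSum v X := by
  simp [linSum]

lemma linSum_zero (T : BasedMatrix H) (X : Set T.G) : T.linSum 0 X = 0 := by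
  simp [linSum]

/-- The annulator of a partition `r` of `G`: all `v ∈ ℤ[G°]` for which there is an integer `k` with
`b (v, χ_C) = k b (s, χ_C)` for every class `C`. The class of `c` is `{x | r c x}`. -/
def annulator (T : BasedMatrix H) (r : Setoid T.G) : AddSubgroup (T.Circ → ℤ) where
  carrier := {v | ∃ k : ℤ, ∀ c : T.G, T.linSum v {x | r c x} = k • T.rowSum T.s {x | r c x}}
  zero_mem' := ⟨0, fun c => by simp [linSum_zero]⟩
  add_mem' := by
    rintro v w ⟨k, hk⟩ ⟨l, hl⟩
    exact ⟨k + l, fun c => by rw [linSum_add, hk, hl, add_smul]⟩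
  neg_mem' := by
    rintro v ⟨k, hk⟩
    exact ⟨-k, fun c => by rw [linSum_neg, hk, neg_smul]⟩

/-- The generator of `ℤ[G°]` given by `g ∈ G°`. -/
def gen (T : BasedMatrix H) (g : T.Circ) : T.Circ → ℤ :=
  open Classical in Pi.single g 1

/-- The derived partition: its classes are `{s}` and the classes of the relation
"`g₁ - g₂` or `g₁ + g₂` lies in the annulator" on `G°`. -/
def derived (T : BasedMatrix H) (r : Setoid T.G) : Setoid T.G where
  r x y := (x = T.s ∧ y = T.s) ∨ ∃ (hx : x ≠ T.s) (hy : y ≠ T.s),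
    T.gen ⟨x, hx⟩ - T.gen ⟨y, hy⟩ ∈ T.annulator r ∨ T.gen ⟨x, hx⟩ + T.gen ⟨y, hy⟩ ∈ T.annulator r
  iseqv := by
    refine ⟨fun x => ?_, ?_, ?_⟩
    · by_cases hx : x = T.s
      · exact Or.inl ⟨hx, hx⟩
      · exact Or.inr ⟨hx, hx, Or.inl (by rw [sub_self]; exact zero_mem _)⟩
    · rintro x y (⟨hx, hy⟩ | ⟨hx, hy, h | h⟩)
      · exact Or.inl ⟨hy, hx⟩
      · exact Or.inr ⟨hy, hx, Or.inl (by simpa using neg_mem h)⟩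
      · exact Or.inr ⟨hy, hx, Or.inr (by rwa [add_comm])⟩
    · rintro x y z (⟨hx, hy⟩ | ⟨hx, hy, h⟩) (⟨hy', hz⟩ | ⟨hy', hz, h'⟩)
      · exact Or.inl ⟨hx, hz⟩
      · exact absurd hy hy'
      · exact absurd hy' hy
      · refine Or.inr ⟨hx, hz, ?_⟩
        rcases h with h | h <;> rcases h' with h' | h'
        · exact Or.inl (by simpa using add_mem h h')
        · exact Or.inr (by simpa [add_assoc, sub_eq_add_neg] using add_mem h h')
        · have h2 := sub_mem h h'
          rw [show T.gen ⟨x, hx⟩ + T.gen ⟨y, hy⟩ - (T.gen ⟨y, hy'⟩ - T.gen ⟨z, hz⟩)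
            = T.gen ⟨x, hx⟩ + T.gen ⟨z, hz⟩ by abel] at h2
          exact Or.inr h2
        · have h2 := sub_mem h h'
          rw [show T.gen ⟨x, hx⟩ + T.gen ⟨y, hy⟩ - (T.gen ⟨y, hy'⟩ + T.gen ⟨z, hz⟩)
            = T.gen ⟨x, hx⟩ - T.gen ⟨z, hz⟩ by abel] at h2
          exact Or.inl h2

/-- The stable partition `𝔠_∞`, the limit of the coarser and coarser partitions `𝔠_n`, where `𝔠_0`
is the partition into singletons and `𝔠_{n+1}` is derived from `𝔠_n`. Its classes are the
(stable) tribes. -/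
def stable (T : BasedMatrix H) : Setoid T.G := ⨆ n : ℕ, T.derived^[n] ⊥

/-- The based matrix obtained from `T` by adjoining one annihilating element, `none`. -/
def adjoinAnnihilating (T : BasedMatrix H) : BasedMatrix H where
  G := Option T.G
  s := some T.s
  b
    | some g, some h => T.b g h
    | _, _ => 0
  skew := by
    rintro (_ | g) (_ | h)
    · simp
    · simp
    · simp
    · exact T.skew g h

/-- The zero tribe (possibly empty): the trace on `G` of the tribe that contains the annihilating
elements after one annihilating element has been adjoined to `T`. (That tribe also contains all core
elements. The adjunction is needed since `T` itself may have no annihilating or core element while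
some homologous matrix has one.) -/
def zeroTribe (T : BasedMatrix H) : Set T.G :=
  {g | T.adjoinAnnihilating.stable (some g) none}

/-! ## The reduced stable parity -/

/-- The finest partition that is coarser than the stable partition and has only classes that are
invariant under all automorphisms of the based matrix. -/
def barPartition (T : BasedMatrix H) : Setoid T.G :=
  sInf {r | T.stable ≤ r ∧ ∀ (φ : Iso T T) (x : T.G), r x (φ.toEquiv x)}

/-- The classes of the partition `barPartition`, without the class that contains the zero tribe. -/
def BarClass (T : BasedMatrix H) : Type :=
  {C : Set T.G // C ∈ T.barPartition.classes ∧ Disjoint C T.zeroTribe}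

/-- The element `b̄(s) = ∑ b (s, χ_C) C` of `H[BarClass]`, which is realised as `BarClass → H`. -/
def barS (T : BasedMatrix H) : T.BarClass → H := fun C => T.rowSum T.s C.1

/-- For a primitive based matrix `T`, the coefficient group `Ā^st(T)` of the reduced stable parity:
the quotient of `H[BarClass]` by the cyclic subgroup generated by `b̄(s)`. -/
abbrev CoeffGroup (T : BasedMatrix H) : Type u :=
  (T.BarClass → H) ⧸ AddSubgroup.zmultiples T.barS

/-- The lift of a union of tribes of `T'` along a chain `f` from `T` to `T'`. Under an operation
`M_i` leading from `T` to `T₁` a tribe `C` of `T₁` corresponds to the tribe `C ∩ G` of `T`. -/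
def Chain.lift {T T' : BasedMatrix H} : Chain T T' → Set T'.G → Set T.G
  | .refl _, X => X
  | .up m f, X => m.ι ⁻¹' (f.lift X)
  | .down (T := T) m f, X => {g | ∃ x ∈ f.lift X, T.stable (m.ι x) g}

/-- The reduced stable parity of `g ∈ G`, for a based matrix `T = (G, s, b)` connected by the
chain `f` with a primitive based matrix `T'`. The chain identifies the classes
of the partition of `T'` with classes of primitive tribes of `T` (the class `C` with
`f.lift C`), and hence the coefficient group of `T` with that of `T'`; under this identification the
parity of `g` is the class of `∑_C (b (g, χ_C) - ⌊|C| / 2⌋ b (g, s)) C`. -/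
def Chain.reducedParity {T T' : BasedMatrix H} (f : Chain T T') (g : T.G) : T'.CoeffGroup :=
  QuotientAddGroup.mk fun C =>
    T.rowSum g (f.lift C.1) - ((f.lift C.1).ncard / 2) • T.b g T.s

end BasedMatrix

/-! ## Flat and virtual knot diagrams

Diagrams are encoded by Gauss diagrams, that is, they are considered up to isotopy and detour
moves. -/

inductive KnotKind
  | flat
  | virtual

/-- The over-undercrossing structure at a classical crossing. For flat diagrams there is none; for
virtual diagrams it says which of the two passages through the crossing is the upper one. -/
def KnotKind.Info : KnotKind → Type
  | .flat => Unit
  | .virtual => Bool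

/-- A diagram of an oriented flat or virtual knot. The set of classical crossings is `V`. The knot
passes twice through every crossing `v`; the passages are labelled `(v, false)` and `(v, true)` in
such a way that the strand of the passage `(v, true)` crosses the strand of `(v, false)` from right
to left. The permutation `next` sends each passage to the passage that follows it along the knot;
there is one unicursal component. -/
structure Diagram (κ : KnotKind) where
  V : Type
  [fintypeV : Fintype V]
  next : Equiv.Perm (V × Bool)
  cyclic : ∀ p q, ∃ k : ℕ, next^[k] p = q
  info : V → κ.Info

attribute [instance] Diagram.fintypeV

namespace Diagram

variable {κ : KnotKind}

/-- The set of edges that form the left half of the diagram at the crossing `c`. The edge that leaves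
a passage `p` is denoted by `p` too. The left half leaves `c` along the outgoing edge on the
left, that of `(c, true)`, and follows the knot until it returns to `c` at `(c, false)`. -/
def leftHalf (D : Diagram κ) (c : D.V) : Set (D.V × Bool) :=
  {p | ∃ k : ℕ, D.next^[k] (c, true) = p ∧ ∀ j ≤ k, D.next^[j] (c, true) ≠ (c, false)}

variable (R : Type*) [CommRing R]

/-- The cycle with coefficients in `R` given by the whole diagram (`none`, the base
element `s`) or by the left half at a crossing. A chain assigns coefficients to edges. -/
def cycle (D : Diagram κ) : Option D.V → D.V × Bool → R
  | none => 1
  | some c => (D.leftHalf c).indicator 1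

variable {R}

/-- The intersection number of two cycles `x`, `y` on the surface of the diagram. If `y` is
pushed slightly to the left of the edges that carry it then, near the crossing `v`, it meets `x`
on the incoming edge of `(v, false)`, with sign `+` and multiplicity that of `y` on the incoming
edge of `(v, true)`, and on the outgoing edge of `(v, true)`, with sign `-` and multiplicity that of
`y` on the outgoing edge of `(v, false)`. -/
def inter (D : Diagram κ) (x y : D.V × Bool → R) : R :=
  ∑ v : D.V, (x (D.next.symm (v, false)) * y (D.next.symm (v, true))
    - x (v, true) * y (v, false))

lemma iterate_mod {α : Type*} (f : α → α) (a : α) (m : ℕ) (h : f^[m] a = a) (n : ℕ) :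
    f^[n % m] a = f^[n] a := by
  conv_rhs => rw [← Nat.mod_add_div n m]
  rw [Function.iterate_add_apply]
  congr 1
  induction n / m with
  | zero => rfl
  | succ k ih => rw [Nat.mul_succ, Function.iterate_add_apply, h]; exact ih

lemma mem_leftHalf_true (D : Diagram κ) (c : D.V) : (c, true) ∈ D.leftHalf c :=
  ⟨0, rfl, fun j hj => by simp [Nat.le_zero.1 hj]⟩

lemma notMem_leftHalf_false (D : Diagram κ) (c : D.V) : (c, false) ∉ D.leftHalf c :=
  fun ⟨k, hk, h⟩ => h k le_rfl hk

lemma prev_true_notMem (D : Diagram κ) (c : D.V) : D.next.symm (c, true) ∉ D.leftHalf c := by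
  rintro ⟨k, hk, h⟩
  have h1 : D.next^[k + 1] (c, true) = (c, true) := by
    rw [Function.iterate_succ_apply', hk, Equiv.apply_symm_apply]
  obtain ⟨n, hn⟩ := D.cyclic (c, true) (c, false)
  refine h (n % (k + 1)) (Nat.lt_succ_iff.1 (Nat.mod_lt _ k.succ_pos)) ?_
  rw [iterate_mod _ _ _ h1, hn]

lemma prev_mem_leftHalf (D : Diagram κ) (c : D.V) (p : D.V × Bool) (hp : p ≠ (c, true))
    (h : p ∈ D.leftHalf c) : D.next.symm p ∈ D.leftHalf c := by
  obtain ⟨k, hk, hk'⟩ := h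
  cases k with
  | zero => exact absurd hk.symm hp
  | succ k =>
    refine ⟨k, ?_, fun j hj => hk' j (by omega)⟩
    rw [← hk, Function.iterate_succ_apply', Equiv.symm_apply_apply]

lemma mem_leftHalf_of_prev (D : Diagram κ) (c : D.V) (p : D.V × Bool) (hp : p ≠ (c, false))
    (h : D.next.symm p ∈ D.leftHalf c) : p ∈ D.leftHalf c := by
  obtain ⟨k, hk, hk'⟩ := h
  have h1 : D.next^[k + 1] (c, true) = p := by
    rw [Function.iterate_succ_apply', hk, Equiv.apply_symm_apply]
  refine ⟨k + 1, h1, fun j hj => ?_⟩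
  rcases Nat.lt_or_eq_of_le hj with hj | rfl
  · exact hk' j (by omega)
  · rwa [h1]

lemma prev_false_mem (D : Diagram κ) (c : D.V) : D.next.symm (c, false) ∈ D.leftHalf c := by
  classical
  have hex := D.cyclic (c, true) (c, false)
  have hn := Nat.find_spec hex
  have hmin : ∀ j < Nat.find hex, D.next^[j] (c, true) ≠ (c, false) :=
    fun j hj => Nat.find_min hex hj
  revert hn hmin
  generalize Nat.find hex = n
  intro hn hmin
  cases n with
  | zero => simp at hn
  | succ n =>
    refine ⟨n, ?_, fun j hj => hmin j (by omega)⟩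
    rw [← hn, Function.iterate_succ_apply', Equiv.symm_apply_apply]

/-- The chains `D.cycle R g` are cycles. -/
lemma cycle_closed (D : Diagram κ) (g : Option D.V) (v : D.V) :
    D.cycle R g (v, false) + D.cycle R g (v, true)
      = D.cycle R g (D.next.symm (v, false)) + D.cycle R g (D.next.symm (v, true)) := by
  classical
  cases g with
  | none => rfl
  | some c =>
    by_cases hv : v = c
    · subst hv
      simp [cycle, Set.indicator, mem_leftHalf_true, notMem_leftHalf_false, prev_true_notMem,
        prev_false_mem]
    · have key : ∀ e : Bool, (v, e) ∈ D.leftHalf c ↔ D.next.symm (v, e) ∈ D.leftHalf c :=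
        fun e => ⟨D.prev_mem_leftHalf c _ (by simp [hv]),
          D.mem_leftHalf_of_prev c _ (by simp [hv])⟩
      simp [cycle, Set.indicator, key]

/-- The intersection number is skew-symmetric on cycles. -/
lemma inter_skew (D : Diagram κ) (x y : D.V × Bool → R)
    (hx : ∀ v, x (v, false) + x (v, true) = x (D.next.symm (v, false)) + x (D.next.symm (v, true)))
    (hy : ∀ v, y (v, false) + y (v, true) = y (D.next.symm (v, false)) + y (D.next.symm (v, true))) :
    D.inter y x = -D.inter x y := by
  rw [eq_neg_iff_add_eq_zero, inter, inter, ← Finset.sum_add_distrib]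
  have h1 : ∑ p : D.V × Bool, x (D.next.symm p) * y (D.next.symm p)
      = ∑ p : D.V × Bool, x p * y p :=
    Equiv.sum_comp D.next.symm fun p => x p * y p
  rw [Fintype.sum_prod_type, Fintype.sum_prod_type] at h1
  simp only [Fintype.sum_bool] at h1
  rw [← sub_eq_zero, ← Finset.sum_sub_distrib] at h1
  rw [← neg_eq_zero, ← h1, ← Finset.sum_neg_distrib]
  refine Finset.sum_congr rfl fun v _ => ?_
  have h2 := congrArg₂ (· * ·) (hx v) (hy v)
  linear_combination h2

/-- The based matrix `T(D)` of a diagram with coefficients in `R`: the set `G` consists of the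
crossings and of `s = none`, and `b` is the intersection number of the left halves at the crossings
and of the whole diagram. -/
def basedMatrix (R : Type*) [CommRing R] (D : Diagram κ) : BasedMatrix R where
  G := Option D.V
  s := none
  b g h := D.inter (D.cycle R g) (D.cycle R h)
  skew g h := D.inter_skew _ _ (D.cycle_closed g) (D.cycle_closed h)

/-- The Gaussian parity of a crossing: the parity of the number of passages through crossings in the
interior of the half at the crossing. -/
def gaussianParity (D : Diagram κ) (c : D.V) : ZMod 2 := ((D.leftHalf c).ncard - 1 : ℕ)

/-! ### Reidemeister moves -/

/-- An isotopy of diagrams. -/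
structure Isotopy (D D' : Diagram κ) where
  e : D.V ≃ D'.V
  next_eq : ∀ p, D'.next (Prod.map e id p) = Prod.map e id (D.next p)
  info_eq : ∀ v, D'.info (e v) = D.info v

/-- The diagram `D` is obtained from `D'` by forgetting the crossings that are not in the image of
`ι`: the passage next to `p` in `D` is the first surviving passage after `p` in `D'`. -/
structure Insertion (D D' : Diagram κ) where
  ι : D.V ↪ D'.V
  next_eq : ∀ p, ∃ k : ℕ, D'.next^[k + 1] (Prod.map ι id p) = Prod.map ι id (D.next p) ∧
    ∀ j < k, (D'.next^[j + 1] (Prod.map ι id p)).1 ∉ Set.range ι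
  info_eq : ∀ v, D'.info (ι v) = D.info v

/-- A first Reidemeister move that adds the crossing `c`, with a loop without crossings on it. -/
structure MoveR1 (D D' : Diagram κ) extends Insertion D D' where
  c : D'.V
  new : ∀ v, v ∉ Set.range ι ↔ v = c
  loop : ∃ β : Bool, D'.next (c, β) = (c, !β)

/-- The condition on the over-undercrossing structure in a second Reidemeister move: one strand is
the upper one at both crossings. (The two passages of a strand through the two crossings have
different labels.) -/
def _root_.KnotParity.KnotKind.R2Info : (κ : KnotKind) → κ.Info → κ.Info → Prop
  | .flat, _, _ => True
  | .virtual, o, o' => o' = Bool.not o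

/-- A second Reidemeister move that adds the crossings `c` and `c'`, which span a bigon. One strand
passes `c` and then `c'`. The other strand passes `c` and then `c'`, or
`c'` and then `c`. -/
structure MoveR2 (D D' : Diagram κ) extends Insertion D D' where
  c : D'.V
  c' : D'.V
  ne : c ≠ c'
  new : ∀ v, v ∉ Set.range ι ↔ (v = c ∨ v = c')
  bigon : ∃ β : Bool, D'.next (c, β) = (c', !β) ∧
    (D'.next (c, !β) = (c', β) ∨ D'.next (c', β) = (c, !β))
  bigon_info : κ.R2Info (D'.info c) (D'.info c')

/-- The condition on the over-undercrossing structure in a third Reidemeister move. At the corner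
`i` of the triangle the side `i - 1` has the passage labelled `β i`. The three sides have
to be ordered by height, that is, the relation "lies above" must not be cyclic. -/
def _root_.KnotParity.KnotKind.R3Info : (κ : KnotKind) → (β : Fin 3 → Bool) → (Fin 3 → κ.Info) → Prop
  | .flat, _, _ => True
  | .virtual, β, o => (∃ i, o i ≠ β i) ∧ ∃ i, o i = β i

/-- A third Reidemeister move. The triangle has the corners `c 0`, `c 1`, `c 2` in counterclockwise
order, and the side `i` joins the corners `c i` and `c (i + 1)`. The number `t i` tells whether the
knot runs along the side `i` from `c i` to `c (i + 1)` or backwards. The move interchanges, on each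
of the three sides, the two passages that bound the side. -/
structure MoveR3 (D D' : Diagram κ) where
  c : Fin 3 → D.V
  c_inj : Function.Injective c
  t : Fin 3 → Bool
  /-- The label of the passage of the side `i - 1` through the corner `c i`; the passage of the
  side `i` has the other label. -/
  β : Fin 3 → Bool
  β_eq : ∀ i, β i = Bool.xor (t (i - 1)) (t i)
  side : ∀ i, if t i then D.next (c i, !(β i)) = (c (i + 1), β (i + 1))
    else D.next (c (i + 1), β (i + 1)) = (c i, !(β i))
  corner_info : κ.R3Info β fun i => D.info (c i)
  e : D.V ≃ D'.V
  /-- The permutation that interchanges the two ends of each side. -/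
  swap : Equiv.Perm (D.V × Bool)
  swap_first : ∀ i, swap (c i, !(β i)) = (c (i + 1), β (i + 1))
  swap_last : ∀ i, swap (c (i + 1), β (i + 1)) = (c i, !(β i))
  swap_other : ∀ p, (∀ i, p.1 ≠ c i) → swap p = p
  next_eq : ∀ p, D'.next (Prod.map e id (swap p)) = Prod.map e id (swap (D.next p))
  info_eq : ∀ v, D'.info (e v) = D.info v

/-- The incidence sign of the corner `i` in a third Reidemeister move: `1` if the two sides of the
triangle at this corner are oriented coherently along the boundary of the triangle, else `-1`. -/
def MoveR3.sign {D D' : Diagram κ} (m : MoveR3 D D') (i : Fin 3) : ℤ :=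
  if m.t (i - 1) = m.t i then 1 else -1

/-- One diagram is obtained from another by an isotopy or a Reidemeister move. -/
def Step (D D' : Diagram κ) : Prop :=
  Nonempty (Isotopy D D') ∨ Nonempty (MoveR1 D D') ∨ Nonempty (MoveR2 D D') ∨
    Nonempty (MoveR3 D D')

end Diagram

/-- A flat or virtual knot: a class of diagrams modulo the equivalence relation generated by
isotopies and Reidemeister moves. -/
def Knot (κ : KnotKind) : Type 1 := Quot (Diagram.Step (κ := κ))

/-- `D` is a diagram of the knot `K`. -/
def Diagram.IsDiagramOf {κ : KnotKind} (D : Diagram κ) (K : Knot κ) : Prop := Quot.mk _ D = K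

/-! ## Parities -/

section Parity

variable {κ : KnotKind} (K : Knot κ) {A : Type*} [AddCommGroup A]
  (p : ∀ D : Diagram κ, D.IsDiagramOf K → D.V → A)

/-- The parity axioms for a family of maps `p_D : V(D) → A` on the diagrams of a knot `K`, apart
from the one on the sum of values in a third Reidemeister move: the value of a crossing that
survives under an isotopy or a Reidemeister move does not change, and the sum of the values of the
crossings that take part in a first or second Reidemeister move is zero. -/
structure IsPreParity : Prop where
  isotopy : ∀ (D D' : Diagram κ) (hD : D.IsDiagramOf K) (hD' : D'.IsDiagramOf K)
    (m : Diagram.Isotopy D D') (v : D.V), p D' hD' (m.e v) = p D hD v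
  r1 : ∀ (D D' : Diagram κ) (hD : D.IsDiagramOf K) (hD' : D'.IsDiagramOf K)
    (m : Diagram.MoveR1 D D') (v : D.V), p D' hD' (m.ι v) = p D hD v
  r2 : ∀ (D D' : Diagram κ) (hD : D.IsDiagramOf K) (hD' : D'.IsDiagramOf K)
    (m : Diagram.MoveR2 D D') (v : D.V), p D' hD' (m.ι v) = p D hD v
  r3 : ∀ (D D' : Diagram κ) (hD : D.IsDiagramOf K) (hD' : D'.IsDiagramOf K)
    (m : Diagram.MoveR3 D D') (v : D.V), p D' hD' (m.e v) = p D hD v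
  r1_sum : ∀ (D D' : Diagram κ) (hD' : D'.IsDiagramOf K) (m : Diagram.MoveR1 D D'),
    p D' hD' m.c = 0
  r2_sum : ∀ (D D' : Diagram κ) (hD' : D'.IsDiagramOf K) (m : Diagram.MoveR2 D D'),
    p D' hD' m.c + p D' hD' m.c' = 0

/-- A parity on the diagrams of `K` with coefficients in `A`. -/
structure IsParity : Prop extends IsPreParity K p where
  r3_sum : ∀ (D D' : Diagram κ) (hD : D.IsDiagramOf K) (m : Diagram.MoveR3 D D'),
    ∑ i, p D hD (m.c i) = 0

/-- An oriented parity on the diagrams of `K` with coefficients in `A`: in a third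
Reidemeister move the values are summed with the incidence signs of the three crossings. -/
structure IsOrientedParity : Prop extends IsPreParity K p where
  r3_sum : ∀ (D D' : Diagram κ) (hD : D.IsDiagramOf K) (m : Diagram.MoveR3 D D'),
    ∑ i, m.sign i • p D hD (m.c i) = 0

end Parity

/-- A primitive based matrix `T_•(K)` with coefficients in `R` of a knot: a primitive
based matrix homologous to the based matrix of some diagram of `K`. -/
def IsPrimitiveMatrixOf {κ : KnotKind} {R : Type*} [CommRing R] (K : Knot κ) (T : BasedMatrix R) :
    Prop :=
  T.IsPrimitive ∧ ∃ D : Diagram κ, D.IsDiagramOf K ∧ (D.basedMatrix R).Homologous T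

/-- A choice, for each diagram `D` of `K`, of a chain of operations from `T(D)` to `T`. -/
abbrev ChainSystem {κ : KnotKind} {R : Type*} [CommRing R] (K : Knot κ) (T : BasedMatrix R) :=
  ∀ D : Diagram κ, D.IsDiagramOf K → BasedMatrix.Chain (D.basedMatrix R) T

/-- The reduced stable parity on the diagrams of `K`, with coefficients in the group `Ā^st` of the
primitive based matrix `T`. -/
def reducedStableParity {κ : KnotKind} {R : Type*} [CommRing R] {K : Knot κ} {T : BasedMatrix R}
    (F : ChainSystem K T) (D : Diagram κ) (hD : D.IsDiagramOf K) (c : D.V) : T.CoeffGroup :=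
  (F D hD).reducedParity (some c)

end KnotParity

end

/-!
The theorem rests on a normal form for chains of operations on based matrices.

*Tribes under one operation.* Let `T'` extend `T` by an annihilating element, a core element or a
complementary pair. Complementary elements lie in one class of every derived partition, and the
columns of the new elements in one class add up to `0` or to the column of `s`. The class `{s}`
contributes the relation `b (v, s) = k b (s, s)`, so that the new columns do not change the
condition that defines the annulator. Hence the stable partition of `T'` restricts to that of `T`
(`IsExt.stable_iff`), and the same holds for the zero tribe (`IsExt.mem_zeroTribe`).

*Confluence.* Two sets of new elements can be removed independently, unless they are complementary
pairs `{x, y}` and `{x, z}`. In that case `y` and `z` have the same row, so they lie in one tribe,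
and their transposition is an automorphism. Inverse operations are therefore locally confluent up
to the identification of elements of one tribe (`IsExt.diamond`). It follows that a chain that
ends in a primitive matrix acts on unions of tribes like an embedding obtained by reductions only
(`Chain.exists_red`), and that two such embeddings differ by an isomorphism of the primitive
matrices (`Red.confluence`). This gives the uniqueness of the primitive matrix. Since the
coefficients of the reduced parity are taken over sets of tribes that are invariant under
automorphisms, it also gives the independence of the chain (`IsExt.lift_eq`).

*Values.* A new complementary pair in a set `X` of tribes adds `b (g, s)` to `b (g, χ_X)` and `1`
to `|X| / 2`, and no other new elements occur outside the zero tribe; so the coefficients of the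
parity are invariant (`IsExt.reducedParity_eq`). Linear relations between rows modulo the row of
`s` become relations between values of the parity (`Chain.reducedParity_relation`).

*Diagrams.* A cycle is determined by its jumps at the passages and by one value. The first two
Reidemeister moves are operations on the based matrix (`MoveR1.isExt`, `MoveR2.isExt`). The third
one reverses the order of the two jumps on each side of the triangle; this does not change
intersection numbers (`MoveR3.b_map`). The signed sum of the left halves at the corners of the
triangle is a multiple of the diagram plus the boundary of the triangle, whose intersection number
with every cycle is zero (`MoveR3.exists_relation`).

*The example.* For the Gauss code `0 1 0 2 1 2`, the rows of the based matrix modulo `2` are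
distinct modulo the row of `s`, so the matrix is primitive and its tribes are singletons. Its only
even crossing is fixed by the automorphisms, and it distinguishes the two odd crossings.
-/

noncomputable section

namespace KnotParity

/-! ### Unions of classes -/

/-- A set is saturated for an equivalence relation if it is a union of classes. -/
def IsSat {α : Type*} (r : Setoid α) (X : Set α) : Prop := ∀ ⦃x y⦄, r x y → x ∈ X → y ∈ X

lemma isSat_class {α : Type*} (r : Setoid α) (c : α) : IsSat r {x | r c x} :=
  fun _ _ hxy hx => r.trans hx hxy

/-- A function whose sum over every class of an equivalence relation vanishes has vanishing sum
over every union of classes. -/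
lemma sum_indicator_eq_zero_of_isSat {α : Type*} [Fintype α] {H : Type*} [AddCommGroup H]
    (r : Setoid α) (f : α → H) (hf : ∀ c, ∑ x, Set.indicator {x | r c x} f x = 0)
    {X : Set α} (hX : IsSat r X) : ∑ x, X.indicator f x = 0 := by
  classical
  rw [← Finset.sum_fiberwise Finset.univ (fun x => (Quotient.mk r x))]
  refine Finset.sum_eq_zero fun q _ => ?_
  obtain ⟨c, rfl⟩ := Quotient.exists_rep q
  have key : ∀ x, Quotient.mk r x = Quotient.mk r c ↔ r c x := fun x => by
    rw [Quotient.eq]; exact ⟨fun h => r.symm h, fun h => r.symm h⟩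
  by_cases hc : c ∈ X
  · rw [← hf c, Finset.sum_filter]
    refine Finset.sum_congr rfl fun x _ => ?_
    by_cases hx : r c x
    · have hx' : x ∈ X := hX hx hc
      simp [key, hx, hx', Set.indicator]
    · simp [key, hx, Set.indicator]
  · refine Finset.sum_eq_zero fun x hx => ?_
    rw [Finset.mem_filter, key] at hx
    exact Set.indicator_of_notMem (fun h => hc (hX (r.symm hx.2) h)) _

namespace BasedMatrix

universe u
variable {H : Type u} [AddCommGroup H] {T T' T'' : BasedMatrix H}

/-! ### Row sums -/

lemma rowSum_empty (T : BasedMatrix H) (g : T.G) : T.rowSum g ∅ = 0 := by simp [rowSum]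

lemma rowSum_singleton (T : BasedMatrix H) (g x : T.G) : T.rowSum g {x} = T.b g x := by
  classical
  rw [rowSum, Finset.sum_eq_single x] <;> simp +contextual [Set.indicator]

lemma rowSum_union (T : BasedMatrix H) (g : T.G) {X Y : Set T.G} (h : Disjoint X Y) :
    T.rowSum g (X ∪ Y) = T.rowSum g X + T.rowSum g Y := by
  simp only [rowSum, Set.indicator_union_of_disjoint h, Finset.sum_add_distrib]

lemma rowSum_pair (T : BasedMatrix H) (g : T.G) {x y : T.G} (h : x ≠ y) :
    T.rowSum g {x, y} = T.b g x + T.b g y := by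
  rw [Set.insert_eq, rowSum_union _ _ (by simpa using h), rowSum_singleton, rowSum_singleton]

/-- A linear relation between rows of a based matrix passes to sums over sets of columns. -/
lemma rowSum_relation (T : BasedMatrix H) {ι : Type*} (I : Finset ι) (m : ι → ℤ) (g : ι → T.G)
    (k : ℤ) (h : ∀ x, ∑ i ∈ I, m i • T.b (g i) x = k • T.b T.s x) (X : Set T.G) :
    ∑ i ∈ I, m i • T.rowSum (g i) X = k • T.rowSum T.s X := by
  classical
  simp only [rowSum, Finset.smul_sum]
  rw [Finset.sum_comm]
  refine Finset.sum_congr rfl fun x _ => ?_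
  by_cases hx : x ∈ X <;> simp [hx, h]

/-! ### Derived partitions -/

/-- The relation that defines the derived partition on `G°`, without reference to `ℤ[G°]`: the sign
`ε` distinguishes the two alternatives. -/
def Tied (T : BasedMatrix H) (r : Setoid T.G) (x y : T.G) : Prop :=
  ∃ ε k : ℤ, (ε = 1 ∨ ε = -1) ∧ ∀ c, T.rowSum x {w | r c w} + ε • T.rowSum y {w | r c w} =
    k • T.rowSum T.s {w | r c w}

lemma linSum_gen (T : BasedMatrix H) (g : T.Circ) (X : Set T.G) :
    T.linSum (T.gen g) X = T.rowSum g.1 X := by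
  classical
  rw [linSum, Finset.sum_eq_single g] <;> simp +contextual [gen]

lemma derived_iff (T : BasedMatrix H) (r : Setoid T.G) (x y : T.G) :
    T.derived r x y ↔ (x = T.s ∧ y = T.s) ∨ (x ≠ T.s ∧ y ≠ T.s ∧ T.Tied r x y) := by
  have key (hx : x ≠ T.s) (hy : y ≠ T.s) : (T.gen ⟨x, hx⟩ - T.gen ⟨y, hy⟩ ∈ T.annulator r ∨
      T.gen ⟨x, hx⟩ + T.gen ⟨y, hy⟩ ∈ T.annulator r) ↔ T.Tied r x y := by
    have h1 : ∀ v, v ∈ T.annulator r ↔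
        ∃ k : ℤ, ∀ c : T.G, T.linSum v {x | r c x} = k • T.rowSum T.s {x | r c x} :=
      fun v => Iff.rfl
    simp only [h1, sub_eq_add_neg, linSum_add, linSum_neg, linSum_gen]
    constructor
    · rintro (⟨k, hk⟩ | ⟨k, hk⟩)
      · exact ⟨-1, k, Or.inr rfl, fun c => by simpa using hk c⟩
      · exact ⟨1, k, Or.inl rfl, fun c => by simpa using hk c⟩
    · rintro ⟨ε, k, rfl | rfl, hk⟩
      · exact Or.inr ⟨k, fun c => by simpa using hk c⟩
      · exact Or.inl ⟨k, fun c => by simpa using hk c⟩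
  constructor
  · rintro (h | ⟨hx, hy, h⟩)
    · exact Or.inl h
    · exact Or.inr ⟨hx, hy, (key hx hy).1 h⟩
  · rintro (h | ⟨hx, hy, h⟩)
    · exact Or.inl h
    · exact Or.inr ⟨hx, hy, (key hx hy).2 h⟩

/-- The equation between class sums that ties two elements holds for all unions of classes. -/
lemma sat_of_class {T : BasedMatrix H} {r : Setoid T.G} {x y : T.G} {ε k : ℤ}
    (h : ∀ c, T.rowSum x {w | r c w} + ε • T.rowSum y {w | r c w} =
      k • T.rowSum T.s {w | r c w}) {X : Set T.G} (hX : IsSat r X) :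
    T.rowSum x X + ε • T.rowSum y X = k • T.rowSum T.s X := by
  have key : ∀ Y : Set T.G, ∑ w, Y.indicator (fun w => T.b x w + ε • T.b y w - k • T.b T.s w) w =
      T.rowSum x Y + ε • T.rowSum y Y - k • T.rowSum T.s Y := fun Y => by
    simp only [rowSum, Finset.smul_sum, ← Finset.sum_add_distrib, ← Finset.sum_sub_distrib]
    refine Finset.sum_congr rfl fun w _ => ?_
    by_cases hw : w ∈ Y <;> simp [hw]
  rw [← sub_eq_zero, ← key]
  exact sum_indicator_eq_zero_of_isSat r _ (fun c => by rw [key, sub_eq_zero, h]) hX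

lemma derived_mono (T : BasedMatrix H) : Monotone T.derived := by
  intro r r' hr x y h
  rw [derived_iff] at h ⊢
  refine h.imp_right fun ⟨hx, hy, ε, k, hε, h⟩ => ⟨hx, hy, ε, k, hε, fun c => ?_⟩
  exact sat_of_class h fun a b hab ha => r'.trans ha (hr hab)

lemma derived_s {r : Setoid T.G} {x : T.G} (h : T.derived r T.s x) : x = T.s := by
  rw [derived_iff] at h
  rcases h with h | h
  · exact h.2
  · exact absurd rfl h.1

/-- A linear relation `b x + ε b y = k b s` with `ε = ± 1` between the rows of two elements of `G°`
puts them into one class of every derived partition. -/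
lemma derived_of_rows (r : Setoid T.G) {x y : T.G} (hx : x ≠ T.s) (hy : y ≠ T.s) (ε k : ℤ)
    (hε : ε = 1 ∨ ε = -1) (h : ∀ w, T.b x w + ε • T.b y w = k • T.b T.s w) :
    T.derived r x y := by
  rw [derived_iff]
  refine Or.inr ⟨hx, hy, ε, k, hε, fun c => ?_⟩
  have := T.rowSum_relation Finset.univ ![1, ε] ![x, y] k (by simpa [Fin.sum_univ_two] using h)
    {w | r c w}
  simpa [Fin.sum_univ_two] using this

/-! ### The stable partition -/

lemma iterate_derived_mono (T : BasedMatrix H) : Monotone fun n : ℕ => T.derived^[n] ⊥ :=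
  T.derived_mono.monotone_iterate_of_le_map bot_le

lemma exists_stable_eq (T : BasedMatrix H) : ∃ n : ℕ, ∀ m ≥ n, T.stable = T.derived^[m] ⊥ := by
  have : Finite (Setoid T.G) :=
    Finite.of_injective (fun r : Setoid T.G => (r : T.G → T.G → Prop)) fun r r' h =>
      Setoid.ext fun a b => by rw [show r a b = r' a b from congrFun (congrFun h a) b]
  obtain ⟨n, hn⟩ := WellFoundedGT.monotone_chain_condition
    (⟨fun n : ℕ => T.derived^[n] ⊥, T.iterate_derived_mono⟩ : ℕ →o Setoid T.G)
  refine ⟨n, fun m hm => ?_⟩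
  rw [← show T.derived^[n] ⊥ = T.derived^[m] ⊥ from hn m hm]
  refine le_antisymm (iSup_le fun k => ?_) (le_iSup (fun n : ℕ => T.derived^[n] ⊥) n)
  rcases le_total n k with h | h
  · exact (hn k h).ge
  · exact T.iterate_derived_mono h

lemma derived_stable (T : BasedMatrix H) : T.derived T.stable = T.stable := by
  obtain ⟨n, hn⟩ := T.exists_stable_eq
  conv_lhs => rw [hn n le_rfl]
  rw [hn (n + 1) n.le_succ, Function.iterate_succ_apply']

lemma stable_le_of_derived_le {r : Setoid T.G} (h : T.derived r ≤ r) : T.stable ≤ r := by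
  refine iSup_le fun n => ?_
  induction n with
  | zero => exact bot_le
  | succ n ih => rw [Function.iterate_succ_apply']; exact (T.derived_mono ih).trans h

lemma stable_s {x : T.G} (h : T.stable T.s x) : x = T.s := by
  rw [← derived_stable] at h; exact derived_s h

lemma stable_of_rows {x y : T.G} (hx : x ≠ T.s) (hy : y ≠ T.s) (ε k : ℤ)
    (hε : ε = 1 ∨ ε = -1) (h : ∀ w, T.b x w + ε • T.b y w = k • T.b T.s w) : T.stable x y := by
  rw [← derived_stable]; exact derived_of_rows _ hx hy ε k hε h

/-! ### Elementary extensions -/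

/-- A set of new elements that an operation `M₁`, `M₂` or `M₃` adds. -/
def Removable (T : BasedMatrix H) (N : Set T.G) : Prop :=
  (∃ g, T.Annihilating g ∧ N = {g}) ∨ (∃ g, T.Core g ∧ N = {g}) ∨
    ∃ g g', T.Complementary g g' ∧ N = {g, g'}

/-- Embeddings of based matrices. -/
structure IsEmb (T T' : BasedMatrix H) (ι : T.G → T'.G) : Prop where
  inj : Function.Injective ι
  map_s : ι T.s = T'.s
  map_b : ∀ g h, T'.b (ι g) (ι h) = T.b g h

/-- Elementary extensions: isomorphisms and the inclusions given by the operations `M₁`, `M₂`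
and `M₃`. -/
structure IsExt (T T' : BasedMatrix H) (ι : T.G → T'.G) : Prop extends IsEmb T T' ι where
  compl : (Set.range ι)ᶜ = ∅ ∨ T'.Removable (Set.range ι)ᶜ

lemma Op.removable (m : Op T T') : T'.Removable (Set.range m.ι)ᶜ := by
  rcases m.new_elements with ⟨g, hg, h⟩ | ⟨g, hg, h⟩ | ⟨g, g', hg, h⟩
  · exact Or.inl ⟨g, hg, Set.ext fun x => h x⟩
  · exact Or.inr (Or.inl ⟨g, hg, Set.ext fun x => h x⟩)
  · exact Or.inr (Or.inr ⟨g, g', hg, Set.ext fun x => h x⟩)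

lemma Op.isExt (m : Op T T') : IsExt T T' m.ι :=
  ⟨⟨m.ι.injective, m.map_s, m.map_b⟩, Or.inr m.removable⟩

/-- The operation given by an embedding with removable complement. -/
def Op.ofEmb (ι : T.G → T'.G) (h : IsEmb T T' ι) (h' : T'.Removable (Set.range ι)ᶜ) : Op T T' where
  ι := ⟨ι, h.inj⟩
  map_s := h.map_s
  map_b := h.map_b
  new_elements := by
    rcases h' with ⟨g, hg, h⟩ | ⟨g, hg, h⟩ | ⟨g, g', hg, h⟩
    · exact Or.inl ⟨g, hg, fun x => Set.ext_iff.1 h x⟩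
    · exact Or.inr (Or.inl ⟨g, hg, fun x => Set.ext_iff.1 h x⟩)
    · exact Or.inr (Or.inr ⟨g, g', hg, fun x => Set.ext_iff.1 h x⟩)

lemma IsEmb.comp {ι : T.G → T'.G} {κ : T'.G → T''.G} (h : IsEmb T T' ι) (h' : IsEmb T' T'' κ) :
    IsEmb T T'' (κ ∘ ι) :=
  ⟨h'.inj.comp h.inj, by simp [h.map_s, h'.map_s], fun a b => by simp [h.map_b, h'.map_b]⟩

lemma Iso.isEmb (e : Iso T T') : IsEmb T T' e.toEquiv := ⟨e.toEquiv.injective, e.map_s, e.map_b⟩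

lemma Iso.isExt (e : Iso T T') : IsExt T T' e.toEquiv :=
  ⟨e.isEmb, Or.inl (by simp [e.toEquiv.surjective.range_eq])⟩

/-- The inverse of an isomorphism. -/
def Iso.symm (e : Iso T T') : Iso T' T where
  toEquiv := e.toEquiv.symm
  map_s := by rw [Equiv.symm_apply_eq, e.map_s]
  map_b g h := by rw [← e.map_b, Equiv.apply_symm_apply, Equiv.apply_symm_apply]

/-- The composition of isomorphisms. -/
def Iso.trans (e : Iso T T') (e' : Iso T' T'') : Iso T T'' where
  toEquiv := e.toEquiv.trans e'.toEquiv
  map_s := by simp [e.map_s, e'.map_s]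
  map_b g h := by simp [e.map_b, e'.map_b]

/-- A surjective embedding is an isomorphism. -/
def Iso.ofEmb (ι : T.G → T'.G) (h : IsEmb T T' ι) (h' : Function.Surjective ι) : Iso T T' where
  toEquiv := Equiv.ofBijective ι ⟨h.inj, h'⟩
  map_s := h.map_s
  map_b := h.map_b

lemma Annihilating.b_right {g : T.G} (h : T.Annihilating g) (x : T.G) : T.b x g = 0 := by
  rw [T.skew g x, h.2, neg_zero]

lemma Core.b_right {g : T.G} (h : T.Core g) (x : T.G) : T.b x g = T.b x T.s := by
  rw [T.skew g x, h.2, T.skew T.s x]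

lemma Complementary.b_right {g g' : T.G} (h : T.Complementary g g') (x : T.G) :
    T.b x g + T.b x g' = T.b x T.s := by
  rw [T.skew g x, T.skew g' x, T.skew T.s x, ← h.2.2.2 x]; abel

lemma Removable.s_notMem {N : Set T.G} (h : T.Removable N) : T.s ∉ N := by
  rcases h with ⟨g, hg, rfl⟩ | ⟨g, hg, rfl⟩ | ⟨g, g', hg, rfl⟩
  · exact fun h => hg.1 h.symm
  · exact fun h => hg.1 h.symm
  · rintro (h | h)
    · exact hg.1 h.symm
    · exact hg.2.1 h.symm

/-- The elements added by an elementary extension lie in one class of every derived partition. -/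
lemma IsExt.derived_new {ι : T.G → T'.G} (h : IsExt T T' ι) (r : Setoid T'.G) {x y : T'.G}
    (hx : x ∉ Set.range ι) (hy : y ∉ Set.range ι) : T'.derived r x y := by
  rw [← Set.mem_compl_iff] at hx hy
  rcases h.compl with h | ⟨g, hg, h⟩ | ⟨g, hg, h⟩ | ⟨g, g', hg, h⟩ <;> rw [h] at hx hy
  · exact absurd hx (Set.notMem_empty _)
  · rw [Set.mem_singleton_iff.1 hx, Set.mem_singleton_iff.1 hy]
  · rw [Set.mem_singleton_iff.1 hx, Set.mem_singleton_iff.1 hy]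
  · have key : T'.derived r g g' :=
      derived_of_rows r hg.1 hg.2.1 1 1 (Or.inl rfl) (by simpa using hg.2.2.2)
    rcases hx with rfl | rfl <;> rcases hy with rfl | rfl
    · rfl
    · exact key
    · exact (T'.derived r).symm key
    · rfl

lemma IsExt.stable_new {ι : T.G → T'.G} (h : IsExt T T' ι) {x y : T'.G}
    (hx : x ∉ Set.range ι) (hy : y ∉ Set.range ι) : T'.stable x y := by
  rw [← derived_stable]; exact h.derived_new _ hx hy

/-- The sum of a row over a set of columns of an extension is the sum over the old columns plus
the sum over the new columns. -/
lemma IsEmb.rowSum_eq {ι : T.G → T'.G} (h : IsEmb T T' ι) (g : T.G) (X : Set T'.G) :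
    T'.rowSum (ι g) X = T.rowSum g (ι ⁻¹' X) + T'.rowSum (ι g) (X ∩ (Set.range ι)ᶜ) := by
  have h1 : T.rowSum g (ι ⁻¹' X) = T'.rowSum (ι g) (X ∩ Set.range ι) := by
    refine Fintype.sum_of_injective ι h.inj _ _ (fun x hx => ?_) fun x => ?_
    · exact Set.indicator_of_notMem (fun h => hx h.2) _
    · by_cases hx : ι x ∈ X <;> simp [Set.indicator, hx, h.map_b]
  rw [h1, ← rowSum_union _ _ (by
    rw [Set.disjoint_left]; exact fun x hx hx' => hx'.2 hx.2), Set.inter_union_compl]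

/-- The new columns inside a union of classes contribute a multiple of the column of `s`. -/
lemma IsExt.rowSum_new {ι : T.G → T'.G} (h : IsExt T T' ι) {X : Set T'.G}
    (hX : ∀ x y, x ∉ Set.range ι → y ∉ Set.range ι → x ∈ X → y ∈ X) :
    ∃ m : ℤ, ∀ g, T'.rowSum g (X ∩ (Set.range ι)ᶜ) = m • T'.b g T'.s := by
  by_cases hne : X ∩ (Set.range ι)ᶜ = ∅
  · exact ⟨0, fun g => by rw [hne, rowSum_empty, zero_smul]⟩
  · obtain ⟨x, hx, hx'⟩ := Set.nonempty_iff_ne_empty.2 hne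
    have h1 : X ∩ (Set.range ι)ᶜ = (Set.range ι)ᶜ :=
      Set.inter_eq_right.2 fun y hy => hX x y hx' hy hx
    rcases h.compl with h | ⟨g, hg, h⟩ | ⟨g, hg, h⟩ | ⟨g, g', hg, h⟩ <;> rw [h1]
    · exact absurd (h ▸ hx') (Set.notMem_empty _)
    · exact ⟨0, fun y => by rw [h, rowSum_singleton, hg.b_right, zero_smul]⟩
    · exact ⟨1, fun y => by rw [h, rowSum_singleton, hg.b_right, one_smul]⟩
    · exact ⟨1, fun y => by rw [h, rowSum_pair _ _ hg.2.2.1, hg.b_right, one_smul]⟩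

lemma IsEmb.ne_s_iff {ι : T.G → T'.G} (h : IsEmb T T' ι) (x : T.G) : ι x = T'.s ↔ x = T.s := by
  rw [← h.map_s, h.inj.eq_iff]

/-- The derived partition commutes with the restriction along an elementary extension, if the new
elements form a part of one class. The class `{s}` gives the relation
`b (v, s) = k b (s, s)`, which makes the contributions of the new columns cancel. -/
lemma IsExt.derived_iff {ι : T.G → T'.G} (h : IsExt T T' ι) {r : Setoid T.G} {r' : Setoid T'.G}
    (hs : ∀ x, r' T'.s x → x = T'.s)
    (hN : ∀ x y, x ∉ Set.range ι → y ∉ Set.range ι → r' x y)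
    (hr : ∀ x y, r x y ↔ r' (ι x) (ι y)) (x y : T.G) :
    T.derived r x y ↔ T'.derived r' (ι x) (ι y) := by
  rw [BasedMatrix.derived_iff, BasedMatrix.derived_iff, Ne, Ne, Ne, Ne, h.ne_s_iff, h.ne_s_iff]
  refine or_congr_right (and_congr_right fun _ => and_congr_right fun _ => ?_)
  have hsat : ∀ X, IsSat r' X → IsSat r (ι ⁻¹' X) := fun X hX a b hab ha => hX ((hr a b).1 hab) ha
  have hnew : ∀ X, IsSat r' X → ∃ m : ℤ, ∀ g,
      T'.rowSum (ι g) X = T.rowSum g (ι ⁻¹' X) + m • T.b g T.s := fun X hX => by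
    obtain ⟨m, hm⟩ := h.rowSum_new fun x y hx hy hx' => hX (hN x y hx hy) hx'
    exact ⟨m, fun g => by rw [h.rowSum_eq, hm, ← h.map_s, h.map_b]⟩
  have hcls' : {w | r' T'.s w} = {T'.s} :=
    Set.ext fun w => ⟨fun hw => hs w hw,
      fun hw => by rw [Set.mem_singleton_iff.1 hw]; exact r'.refl _⟩
  have hcls : {w | r T.s w} = {T.s} := Set.ext fun w =>
    ⟨fun hw => (h.ne_s_iff w).1 (hs _ (by rw [← h.map_s]; exact (hr _ _).1 hw)),
      fun hw => by rw [Set.mem_singleton_iff.1 hw]; exact r.refl _⟩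
  constructor
  · rintro ⟨ε, k, hε, hk⟩
    refine ⟨ε, k, hε, fun c => ?_⟩
    obtain ⟨m, hm⟩ := hnew _ (isSat_class r' c)
    have h1 := sat_of_class hk (hsat _ (isSat_class r' c))
    have h2 := hk T.s
    rw [hcls, rowSum_singleton, rowSum_singleton, rowSum_singleton] at h2
    rw [← h.map_s, hm, hm, hm, smul_add k, ← h1, smul_comm k m, ← h2, smul_add, smul_add,
      smul_comm ε m]
    abel
  · rintro ⟨ε, k, hε, hk⟩
    refine ⟨ε, k, hε, fun c => ?_⟩
    obtain ⟨m, hm⟩ := hnew _ (isSat_class r' (ι c))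
    have h1 := hk (ι c)
    have h2 := hk T'.s
    rw [hcls', rowSum_singleton, rowSum_singleton, rowSum_singleton, ← h.map_s, h.map_b, h.map_b,
      h.map_b] at h2
    have hc : {w | r c w} = ι ⁻¹' {w | r' (ι c) w} := Set.ext fun w => hr c w
    rw [← h.map_s, hm, hm, hm, ← hc, smul_add k, smul_comm k m, ← h2, smul_add, smul_add,
      smul_comm ε m] at h1
    exact add_right_cancel (b := m • T.b x T.s + m • ε • T.b y T.s) (by rw [← h1]; abel)

/-- The stable partition is compatible with elementary extensions: tribes restrict to tribes. -/
theorem IsExt.stable_iff {ι : T.G → T'.G} (h : IsExt T T' ι) (x y : T.G) :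
    T'.stable (ι x) (ι y) ↔ T.stable x y := by
  constructor
  · -- The partition of `T'` into the tribes of `T` and the set of new elements restricts to
    -- `T.stable`, and so do all partitions derived from it. They bound `T'.stable` from above.
    set ψ : T'.G → Option (Quotient T.stable) :=
      Function.extend ι (fun a => some (Quotient.mk _ a)) fun _ => none with hψ
    have hψ1 : ∀ a, ψ (ι a) = some (Quotient.mk _ a) := fun a => h.inj.extend_apply _ _ a
    have hψ2 : ∀ a, a ∉ Set.range ι → ψ a = none := fun a ha => Function.extend_apply' _ _ _ ha
    have key : ∀ n : ℕ, (∀ x, T'.derived^[n] (Setoid.ker ψ) T'.s x → x = T'.s) ∧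
        (∀ x y, x ∉ Set.range ι → y ∉ Set.range ι → T'.derived^[n] (Setoid.ker ψ) x y) ∧
        (∀ x y, T.stable x y ↔ T'.derived^[n] (Setoid.ker ψ) (ι x) (ι y)) := by
      intro n
      induction n with
      | zero =>
        refine ⟨fun x hx => ?_, fun x y hx hy => ?_, fun x y => ?_⟩
        · have hx : ψ T'.s = ψ x := hx
          rw [← h.map_s, hψ1] at hx
          by_cases hx' : x ∈ Set.range ι
          · obtain ⟨a, rfl⟩ := hx'
            rw [hψ1, Option.some_inj, Quotient.eq] at hx
            rw [stable_s hx, h.map_s]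
          · rw [hψ2 x hx'] at hx; exact absurd hx (by simp)
        · change ψ x = ψ y
          rw [hψ2 x hx, hψ2 y hy]
        · change _ ↔ ψ (ι x) = ψ (ι y)
          rw [hψ1, hψ1, Option.some_inj, Quotient.eq]
      | succ n ih =>
        obtain ⟨h1, h2, h3⟩ := ih
        rw [Function.iterate_succ_apply']
        refine ⟨fun x hx => derived_s hx, fun x y hx hy => h.derived_new _ hx hy, fun x y => ?_⟩
        rw [← h.derived_iff h1 h2 h3, derived_stable]
    intro hxy
    obtain ⟨n, hn⟩ := T'.exists_stable_eq
    rw [hn n le_rfl] at hxy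
    exact ((key n).2.2 x y).2 ((T'.derived_mono.iterate n) bot_le hxy)
  · have h1 : T.stable ≤ Setoid.comap ι T'.stable := by
      refine stable_le_of_derived_le fun a b hab => ?_
      have := (h.derived_iff (r := Setoid.comap ι T'.stable) (fun x => stable_s)
        (fun x y => h.stable_new) (fun x y => Iff.rfl) a b).1 hab
      rwa [derived_stable] at this
    exact fun hxy => h1 hxy

/-! ### The zero tribe -/

lemma isExt_adjoin (T : BasedMatrix H) : IsExt T T.adjoinAnnihilating some := by
  refine ⟨⟨Option.some_injective _, rfl, fun _ _ => rfl⟩, Or.inr (Or.inl ⟨none, ⟨?_, ?_⟩, ?_⟩)⟩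
  · exact Option.some_ne_none _ |>.symm
  · rintro (_ | h) <;> rfl
  · exact Set.compl_range_some T.G

lemma IsExt.adjoin {ι : T.G → T'.G} (h : IsExt T T' ι) :
    IsExt T.adjoinAnnihilating T'.adjoinAnnihilating (Option.map ι) := by
  have hc : (Set.range (Option.map ι))ᶜ = some '' (Set.range ι)ᶜ := by
    ext x; cases x <;> simp
  have hne : ∀ {g : T'.G}, g ≠ T'.s →
      (some g : T'.adjoinAnnihilating.G) ≠ T'.adjoinAnnihilating.s :=
    fun hg h' => hg (Option.some_injective _ h')
  refine ⟨⟨Option.map_injective h.inj, congrArg some h.map_s, ?_⟩, ?_⟩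
  · rintro (_ | a) (_ | b)
    · rfl
    · rfl
    · rfl
    · exact h.map_b a b
  · refine h.compl.imp (fun h => ?_) fun h' => ?_
    · exact hc.trans (by rw [h]; exact Set.image_empty _)
    · rcases h' with ⟨g, hg, h'⟩ | ⟨g, hg, h'⟩ | ⟨g, g', hg, h'⟩
      · refine Or.inl ⟨some g, ⟨hne hg.1, ?_⟩, hc.trans (by rw [h']; exact Set.image_singleton)⟩
        rintro (_ | x)
        exacts [rfl, hg.2 x]
      · refine Or.inr (Or.inl ⟨some g, ⟨hne hg.1, ?_⟩,
          hc.trans (by rw [h']; exact Set.image_singleton)⟩)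
        rintro (_ | x)
        exacts [rfl, hg.2 x]
      · refine Or.inr (Or.inr ⟨some g, some g', ⟨hne hg.1, hne hg.2.1, ?_, ?_⟩,
          hc.trans (by rw [h']; exact Set.image_pair _ _ _)⟩)
        · exact fun h => hg.2.2.1 (Option.some_injective _ h)
        · rintro (_ | x)
          exacts [add_zero 0, hg.2.2.2 x]

lemma IsExt.mem_zeroTribe {ι : T.G → T'.G} (h : IsExt T T' ι) (g : T.G) :
    ι g ∈ T'.zeroTribe ↔ g ∈ T.zeroTribe :=
  h.adjoin.stable_iff (some g) none

lemma isSat_zeroTribe (T : BasedMatrix H) : IsSat T.stable T.zeroTribe := fun x y hxy hx =>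
  Setoid.trans' _ (Setoid.symm' _ ((T.isExt_adjoin.stable_iff x y).2 hxy)) hx

lemma Annihilating.mem_zeroTribe {g : T.G} (h : T.Annihilating g) : g ∈ T.zeroTribe := by
  refine stable_of_rows (T := T.adjoinAnnihilating) ?_ ?_ 1 0 (Or.inl rfl) ?_
  · exact fun h' => h.1 (Option.some_injective _ h')
  · exact (Option.some_ne_none _).symm
  · rintro (_ | x)
    · simp [adjoinAnnihilating]
    · simp [adjoinAnnihilating, h.2 x]

lemma Core.mem_zeroTribe {g : T.G} (h : T.Core g) : g ∈ T.zeroTribe := by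
  refine stable_of_rows (T := T.adjoinAnnihilating) ?_ ?_ 1 1 (Or.inl rfl) ?_
  · exact fun h' => h.1 (Option.some_injective _ h')
  · exact (Option.some_ne_none _).symm
  · rintro (_ | x)
    · simp [adjoinAnnihilating]
    · simp [adjoinAnnihilating, h.2 x]

end BasedMatrix

namespace BasedMatrix

universe u
variable {H : Type u} [AddCommGroup H] {T T' T'' : BasedMatrix H}

/-! ### Confluence of reductions -/

lemma isPrimitive_iff : T.IsPrimitive ↔ ∀ N, ¬ T.Removable N := by
  constructor
  · rintro ⟨h1, h2, h3⟩ N (⟨g, hg, -⟩ | ⟨g, hg, -⟩ | ⟨g, g', hg, -⟩)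
    exacts [h1 g hg, h2 g hg, h3 g g' hg]
  · exact fun h => ⟨fun g hg => h _ (Or.inl ⟨g, hg, rfl⟩),
      fun g hg => h _ (Or.inr (Or.inl ⟨g, hg, rfl⟩)),
      fun g g' hg => h _ (Or.inr (Or.inr ⟨g, g', hg, rfl⟩))⟩

lemma IsEmb.removable_preimage {ι : T.G → T'.G} (h : IsEmb T T' ι) {N : Set T'.G}
    (hN : T'.Removable N) (hN' : N ⊆ Set.range ι) : T.Removable (ι ⁻¹' N) := by
  rcases hN with ⟨g, hg, rfl⟩ | ⟨g, hg, rfl⟩ | ⟨g, g', hg, rfl⟩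
  · obtain ⟨a, rfl⟩ := hN' rfl
    refine Or.inl ⟨a, ⟨fun ha => hg.1 ((h.ne_s_iff a).2 ha), fun x => ?_⟩, ?_⟩
    · rw [← h.map_b, hg.2]
    · ext x; simp [h.inj.eq_iff]
  · obtain ⟨a, rfl⟩ := hN' rfl
    refine Or.inr (Or.inl ⟨a, ⟨fun ha => hg.1 ((h.ne_s_iff a).2 ha), fun x => ?_⟩, ?_⟩)
    · rw [← h.map_b, hg.2, ← h.map_s, h.map_b]
    · ext x; simp [h.inj.eq_iff]
  · obtain ⟨a, rfl⟩ := hN' (Or.inl rfl)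
    obtain ⟨a', rfl⟩ := hN' (Or.inr rfl)
    refine Or.inr (Or.inr ⟨a, a', ⟨fun ha => hg.1 ((h.ne_s_iff a).2 ha),
      fun ha => hg.2.1 ((h.ne_s_iff a').2 ha), fun ha => hg.2.2.1 (congrArg ι ha),
      fun x => ?_⟩, ?_⟩)
    · rw [← h.map_b, ← h.map_b a', hg.2.2.2, ← h.map_s, h.map_b]
    · ext x; simp [h.inj.eq_iff]

/-- An embedding whose range lies in the range of a second one factors through it. -/
lemma IsEmb.exists_lift {ι : T.G → T''.G} {κ : T'.G → T''.G} (h : IsEmb T T'' ι)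
    (h' : IsEmb T' T'' κ) (hr : Set.range ι ⊆ Set.range κ) :
    ∃ γ, IsEmb T T' γ ∧ ∀ x, κ (γ x) = ι x := by
  choose γ hγ using fun x => hr ⟨x, rfl⟩
  refine ⟨γ, ⟨fun x y hxy => h.inj (by rw [← hγ, hxy, hγ]), h'.inj ?_, fun x y => ?_⟩, hγ⟩
  · rw [hγ, h.map_s, h'.map_s]
  · rw [← h'.map_b, hγ, hγ, h.map_b]

/-- The based matrix obtained from `T` by deleting a set of elements. -/
def delete (T : BasedMatrix H) (N : Set T.G) (hN : T.s ∉ N) : BasedMatrix H where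
  G := {x : T.G // x ∉ N}
  fintypeG := Fintype.ofFinite _
  s := ⟨T.s, hN⟩
  b x y := T.b x y
  skew x y := T.skew x y

lemma isEmb_delete (T : BasedMatrix H) (N : Set T.G) (hN : T.s ∉ N) :
    IsEmb (T.delete N hN) T Subtype.val :=
  ⟨Subtype.val_injective, rfl, fun _ _ => rfl⟩

lemma range_delete (T : BasedMatrix H) (N : Set T.G) :
    Set.range (Subtype.val : {x : T.G // x ∉ N} → T.G) = Nᶜ := by
  ext x; simp

/-- Two removable sets can be removed independently, unless both are complementary pairs with one
common element; then the other elements of the pairs have equal rows. -/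
lemma Removable.diff {N N' : Set T.G} (h : N = ∅ ∨ T.Removable N) (h' : N' = ∅ ∨ T.Removable N') :
    ((N \ N' = ∅ ∨ T.Removable (N \ N')) ∧ (N' \ N = ∅ ∨ T.Removable (N' \ N))) ∨
    ∃ x y z, x ≠ y ∧ x ≠ z ∧ y ≠ z ∧ y ≠ T.s ∧ z ≠ T.s ∧ (∀ w, T.b y w = T.b z w) ∧
      N = {x, y} ∧ N' = {x, z} := by
  classical
  -- removal of an annihilating or a core element
  have single : ∀ {g : T.G} {M : Set T.G}, (T.Annihilating g ∨ T.Core g) →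
      (M = ∅ ∨ T.Removable M) →
      (M \ {g} = ∅ ∨ T.Removable (M \ {g})) ∧ ({g} \ M = ∅ ∨ T.Removable ({g} \ M)) := by
    intro g M hg hM
    have hgr : T.Removable {g} :=
      hg.elim (fun h => Or.inl ⟨g, h, rfl⟩) fun h => Or.inr (Or.inl ⟨g, h, rfl⟩)
    by_cases hgM : g ∈ M
    swap
    · rw [Set.sdiff_singleton_eq_self hgM, sdiff_eq_left.2 (by simpa using hgM)]
      exact ⟨hM, Or.inr hgr⟩
    · refine ⟨?_, Or.inl (Set.sdiff_eq_empty.2 (by simpa using hgM))⟩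
      have other : ∀ {a : T.G}, (a ≠ T.s) → (∀ w, T.b g w + T.b a w = T.b T.s w) →
          T.Removable {a} := by
        intro a ha haw
        rcases hg with hg | hg
        · exact Or.inr (Or.inl ⟨a, ⟨ha, fun w => by rw [← haw, hg.2, zero_add]⟩, rfl⟩)
        · exact Or.inl ⟨a, ⟨ha, fun w => by simpa [hg.2] using haw w⟩, rfl⟩
      rcases hM with rfl | ⟨a, ha, rfl⟩ | ⟨a, ha, rfl⟩ | ⟨a, a', ha, rfl⟩
      · exact absurd hgM (Set.notMem_empty _)
      · left; rw [Set.mem_singleton_iff.1 hgM]; simp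
      · left; rw [Set.mem_singleton_iff.1 hgM]; simp
      · right
        rcases hgM with rfl | rfl
        · have : ({g, a'} : Set T.G) \ {g} = {a'} := by
            ext w; simp only [Set.mem_sdiff, Set.mem_insert_iff, Set.mem_singleton_iff]
            have := ha.2.2.1; grind
          rw [this]
          exact other ha.2.1 ha.2.2.2
        · have : ({a, g} : Set T.G) \ {g} = {a} := by
            ext w; simp only [Set.mem_sdiff, Set.mem_insert_iff, Set.mem_singleton_iff]
            have := ha.2.2.1; grind
          rw [this]
          exact other ha.1 fun w => by rw [add_comm, ha.2.2.2]
  rcases h with rfl | ⟨g, hg, rfl⟩ | ⟨g, hg, rfl⟩ | h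
  · left; simpa using h'
  · exact Or.inl (single (Or.inl hg) h').symm
  · exact Or.inl (single (Or.inr hg) h').symm
  rcases h' with rfl | ⟨g, hg, rfl⟩ | ⟨g, hg, rfl⟩ | h'
  · left; rw [Set.sdiff_empty, Set.empty_sdiff]; exact ⟨Or.inr (Or.inr (Or.inr h)), Or.inl rfl⟩
  · exact Or.inl (single (Or.inl hg) (Or.inr (Or.inr (Or.inr h))))
  · exact Or.inl (single (Or.inr hg) (Or.inr (Or.inr (Or.inr h))))
  obtain ⟨x, y, hxy, rfl⟩ := h
  obtain ⟨x', y', hxy', rfl⟩ := h'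
  -- two complementary pairs with a common element
  have pairs : ∀ {x y y' : T.G}, T.Complementary x y → T.Complementary x y' →
      (((({x, y} : Set T.G) \ {x, y'} = ∅ ∨ T.Removable ({x, y} \ {x, y'})) ∧
        (({x, y'} : Set T.G) \ {x, y} = ∅ ∨ T.Removable ({x, y'} \ {x, y}))) ∨
      ∃ a b c, a ≠ b ∧ a ≠ c ∧ b ≠ c ∧ b ≠ T.s ∧ c ≠ T.s ∧ (∀ w, T.b b w = T.b c w) ∧
      ({x, y} : Set T.G) = {a, b} ∧ ({x, y'} : Set T.G) = {a, c}) := by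
    intro x y y' h h'
    by_cases hy : y = y'
    · subst hy; left; simp
    · refine Or.inr ⟨x, y, y', h.2.2.1, h'.2.2.1, hy, h.2.1, h'.2.1, fun w => ?_, rfl, rfl⟩
      exact add_left_cancel ((h.2.2.2 w).trans (h'.2.2.2 w).symm)
  have symm : ∀ {x y : T.G}, T.Complementary x y → T.Complementary y x := fun h =>
    ⟨h.2.1, h.1, h.2.2.1.symm, fun w => by rw [add_comm, h.2.2.2]⟩
  by_cases h1 : x = x'
  · subst h1; exact pairs hxy hxy'
  by_cases h2 : x = y'
  · subst h2; rw [Set.pair_comm x' x]; exact pairs hxy (symm hxy')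
  by_cases h3 : y = x'
  · subst h3; rw [Set.pair_comm x y]; exact pairs (symm hxy) hxy'
  by_cases h4 : y = y'
  · subst h4; rw [Set.pair_comm x y, Set.pair_comm x' y]; exact pairs (symm hxy) (symm hxy')
  left
  have hd : Disjoint ({x, y} : Set T.G) {x', y'} := by
    rw [Set.disjoint_left]; simp only [Set.mem_insert_iff, Set.mem_singleton_iff]; grind
  rw [sdiff_eq_left.2 hd, sdiff_eq_left.2 hd.symm]
  exact ⟨Or.inr (Or.inr (Or.inr ⟨x, y, hxy, rfl⟩)), Or.inr (Or.inr (Or.inr ⟨x', y', hxy', rfl⟩))⟩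

lemma IsExt.refl (T : BasedMatrix H) : IsExt T T id :=
  ⟨⟨Function.injective_id, rfl, fun _ _ => rfl⟩, Or.inl (by simp)⟩

/-- The transposition of two elements of `G°` with equal rows is an automorphism. -/
lemma isEmb_swap [DecidableEq T.G] {y z : T.G} (hy : y ≠ T.s) (hz : z ≠ T.s)
    (h : ∀ w, T.b y w = T.b z w) : IsEmb T T (Equiv.swap y z) := by
  have h1 : ∀ a w, T.b (Equiv.swap y z a) w = T.b a w := by
    intro a w
    rw [Equiv.swap_apply_def]
    split_ifs with h1 h2
    · rw [h1, h]
    · rw [h2, h]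
    · rfl
  refine ⟨(Equiv.swap y z).injective, Equiv.swap_apply_of_ne_of_ne hy.symm hz.symm, fun a b => ?_⟩
  rw [h1, T.skew _ a, h1, ← T.skew]

/-- Local confluence: two elementary extensions with the same target have a common source, up to
the identification of elements of one tribe. -/
lemma IsExt.diamond {T₁ T₂ : BasedMatrix H} {ι₁ : T₁.G → T.G} {ι₂ : T₂.G → T.G}
    (h₁ : IsExt T₁ T ι₁) (h₂ : IsExt T₂ T ι₂) :
    ∃ (T₃ : BasedMatrix H) (a : T₃.G → T₁.G) (b : T₃.G → T₂.G), IsExt T₃ T₁ a ∧ IsExt T₃ T₂ b ∧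
      ∀ x, T.stable (ι₁ (a x)) (ι₂ (b x)) := by
  classical
  rcases Removable.diff h₁.compl h₂.compl with
    ⟨h21, h12⟩ | ⟨x, y, z, hxy, hxz, hyz, hy, hz, hw, e₁, e₂⟩
  · -- the common source is the complement of all new elements
    set N : Set T.G := (Set.range ι₁ ∩ Set.range ι₂)ᶜ with hN
    have hs : T.s ∉ N := by
      rw [hN, Set.notMem_compl_iff]; exact ⟨⟨_, h₁.map_s⟩, ⟨_, h₂.map_s⟩⟩
    have hr : Set.range (Subtype.val : {x : T.G // x ∉ N} → T.G) = Set.range ι₁ ∩ Set.range ι₂ := by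
      rw [range_delete, hN, compl_compl]
    obtain ⟨a, ha, ha'⟩ := (T.isEmb_delete N hs).exists_lift h₁.toIsEmb
      (hr.le.trans Set.inter_subset_left)
    obtain ⟨b, hb, hb'⟩ := (T.isEmb_delete N hs).exists_lift h₂.toIsEmb
      (hr.le.trans Set.inter_subset_right)
    have hra : (Set.range a)ᶜ = ι₁ ⁻¹' ((Set.range ι₂)ᶜ \ (Set.range ι₁)ᶜ) := by
      ext w
      have : w ∈ Set.range a ↔ ι₁ w ∈ Set.range ι₁ ∩ Set.range ι₂ := by
        rw [← hr]
        refine ⟨fun ⟨v, hv⟩ => ⟨v, by rw [← hv, ha']⟩, fun ⟨v, hv⟩ => ⟨v, h₁.inj ?_⟩⟩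
        exact (ha' v).trans hv
      simp [this]
    have hrb : (Set.range b)ᶜ = ι₂ ⁻¹' ((Set.range ι₁)ᶜ \ (Set.range ι₂)ᶜ) := by
      ext w
      have : w ∈ Set.range b ↔ ι₂ w ∈ Set.range ι₁ ∩ Set.range ι₂ := by
        rw [← hr]
        refine ⟨fun ⟨v, hv⟩ => ⟨v, by rw [← hv, hb']⟩, fun ⟨v, hv⟩ => ⟨v, h₂.inj ?_⟩⟩
        exact (hb' v).trans hv
      simp [this]
    refine ⟨T.delete N hs, a, b, ⟨ha, ?_⟩, ⟨hb, ?_⟩, fun w => by rw [ha', hb']⟩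
    · rw [hra]
      refine h12.imp (fun h => by rw [h, Set.preimage_empty]) fun h => ?_
      exact h₁.removable_preimage h fun w hw => not_not.1 hw.2
    · rw [hrb]
      refine h21.imp (fun h => by rw [h, Set.preimage_empty]) fun h => ?_
      exact h₂.removable_preimage h fun w hw => not_not.1 hw.2
  · -- the transposition of the elements with equal rows identifies the two sources
    have hσ := isEmb_swap hy hz hw
    have r₁ : ∀ w, w ∈ Set.range ι₁ ↔ w ≠ x ∧ w ≠ y := fun w => by
      rw [← not_iff_not, ← Set.mem_compl_iff, e₁]; simp; tauto
    have r₂ : ∀ w, w ∈ Set.range ι₂ ↔ w ≠ x ∧ w ≠ z := fun w => by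
      rw [← not_iff_not, ← Set.mem_compl_iff, e₂]; simp; tauto
    have hmem : ∀ w, Equiv.swap y z w ∈ Set.range ι₂ ↔ w ∈ Set.range ι₁ := fun w => by
      rw [r₁, r₂, Equiv.swap_apply_def]
      split_ifs <;> grind
    obtain ⟨b, hb, hb'⟩ := (h₁.toIsEmb.comp hσ).exists_lift h₂.toIsEmb (by
      rintro _ ⟨w, rfl⟩; exact (hmem _).2 ⟨w, rfl⟩)
    refine ⟨T₁, id, b, IsExt.refl _, ⟨hb, Or.inl ?_⟩, fun w => ?_⟩
    · rw [Set.compl_empty_iff, Set.range_eq_univ]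
      intro v
      obtain ⟨w, hw⟩ := (hmem (Equiv.swap y z (ι₂ v))).1 (by simp)
      exact ⟨w, h₂.inj (by rw [hb', Function.comp_apply, hw, Equiv.swap_apply_self])⟩
    · rw [hb', id, Function.comp_apply, Equiv.swap_apply_def]
      have key : T.stable y z := stable_of_rows hy hz (-1) 0 (Or.inr rfl) fun w => by simp [hw]
      split_ifs with h1 h2
      · rw [h1]; exact key
      · rw [h2]; exact T.stable.symm key
      · rfl

/-- `Red T T' ρ` says that `T'` is obtained from `T` by isomorphisms and inverses of the operations
`M₁`, `M₂`, `M₃`, and that `ρ` is the resulting embedding of `T'` into `T`. -/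
inductive Red : (T T' : BasedMatrix H) → (T'.G → T.G) → Prop
  | refl (T : BasedMatrix H) : Red T T id
  | step {T T₁ T' : BasedMatrix H} {ι : T₁.G → T.G} {ρ : T'.G → T₁.G} (h : IsExt T₁ T ι)
      (hρ : Red T₁ T' ρ) : Red T T' (ι ∘ ρ)

/-- An elementary extension with primitive target is an isomorphism. -/
lemma IsExt.exists_iso {ι : T.G → T'.G} (h : IsExt T T' ι) (hp : T'.IsPrimitive) :
    ∃ e : Iso T T', ⇑e.toEquiv = ι := by
  rcases h.compl with h' | h'
  · exact ⟨Iso.ofEmb ι h.toIsEmb (by rwa [Set.compl_empty_iff, Set.range_eq_univ] at h'), rfl⟩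
  · exact absurd h' (isPrimitive_iff.1 hp _)

lemma Iso.isPrimitive (e : Iso T T') (hp : T'.IsPrimitive) : T.IsPrimitive := by
  rw [isPrimitive_iff] at hp ⊢
  exact fun N hN => hp _ (e.symm.isEmb.removable_preimage hN
    (by rw [e.symm.toEquiv.surjective.range_eq]; exact Set.subset_univ _))

/-- The inverse of one elementary extension can be put in front of a reduction to a primitive
matrix, up to the identification of elements of one tribe. -/
lemma Red.strip {ρ : T'.G → T.G} (h : Red T T' ρ) (hp : T'.IsPrimitive) :
    ∀ {T₁ : BasedMatrix H} {ι : T₁.G → T.G}, IsExt T₁ T ι →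
      ∃ ρ₁, Red T₁ T' ρ₁ ∧ ∀ x, T.stable (ι (ρ₁ x)) (ρ x) := by
  induction h with
  | refl T =>
    intro T₁ ι h
    obtain ⟨e, rfl⟩ := h.exists_iso hp
    exact ⟨_, Red.step e.symm.isExt (Red.refl T), fun x => by
      rw [Function.comp_apply, show e.toEquiv (e.symm.toEquiv (id x)) = id x from
        e.toEquiv.apply_symm_apply x]⟩
  | step h₂ _ ih =>
    intro T₁ ι h
    obtain ⟨T₃, a, b, ha, hb, hab⟩ := h.diamond h₂
    obtain ⟨ρ₃, h₃, hρ₃⟩ := ih hp hb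
    refine ⟨_, Red.step ha h₃, fun x => Setoid.trans' _ (hab _) ?_⟩
    exact (h₂.stable_iff _ _).2 (hρ₃ x)

lemma Red.exists_iso {ρ : T'.G → T.G} (h : Red T T' ρ) :
    T.IsPrimitive → ∃ e : Iso T' T, ⇑e.toEquiv = ρ := by
  induction h with
  | refl T => exact fun _ => ⟨⟨Equiv.refl _, rfl, fun _ _ => rfl⟩, rfl⟩
  | step h _ ih =>
    intro hp
    obtain ⟨e, rfl⟩ := h.exists_iso hp
    obtain ⟨e', rfl⟩ := ih (e.isPrimitive hp)
    exact ⟨e'.trans e, rfl⟩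

/-- Two reductions of `T` to primitive matrices differ by an isomorphism, up to the
identification of elements of one tribe. -/
theorem Red.confluence {ρ : T'.G → T.G} {ρ' : T''.G → T.G} (h : Red T T' ρ)
    (hp : T'.IsPrimitive) (h' : Red T T'' ρ') (hp' : T''.IsPrimitive) :
    ∃ e : Iso T'' T', ∀ x, T.stable (ρ (e.toEquiv x)) (ρ' x) := by
  induction h with
  | refl T =>
    obtain ⟨e, rfl⟩ := h'.exists_iso hp
    exact ⟨e, fun x => Setoid.refl' _ _⟩
  | step h₁ _ ih =>
    obtain ⟨ρ₁, hρ₁, h₂⟩ := h'.strip hp' h₁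
    obtain ⟨e, he⟩ := ih hp hρ₁
    exact ⟨e, fun x => Setoid.trans' _ ((h₁.stable_iff _ _).2 (he x)) (h₂ x)⟩

/-! ### Chains -/

/-- Every chain that ends in a primitive matrix acts on unions of tribes like a reduction. -/
theorem Chain.exists_red (f : Chain T T') (hp : T'.IsPrimitive) :
    ∃ ρ, Red T T' ρ ∧ ∀ X, IsSat T'.stable X → ∀ g, g ∈ f.lift X ↔ ∃ x ∈ X, T.stable (ρ x) g := by
  induction f with
  | refl T =>
    exact ⟨id, Red.refl T, fun X hX g => ⟨fun h => ⟨g, h, Setoid.refl' _ _⟩,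
      fun ⟨x, hx, h⟩ => hX h hx⟩⟩
  | up m f ih =>
    obtain ⟨ρ₁, h₁, hρ₁⟩ := ih hp
    obtain ⟨ρ, h, hρ⟩ := h₁.strip hp m.isExt
    refine ⟨ρ, h, fun X hX g => (hρ₁ X hX _).trans
      (exists_congr fun x => and_congr_right fun _ => ?_)⟩
    rw [← m.isExt.stable_iff]
    exact ⟨fun h => Setoid.trans' _ (hρ x) h, fun h => Setoid.trans' _ (Setoid.symm' _ (hρ x)) h⟩
  | down m f ih =>
    obtain ⟨ρ₁, h₁, hρ₁⟩ := ih hp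
    refine ⟨_, Red.step m.isExt h₁, fun X hX g => ⟨?_, ?_⟩⟩
    · rintro ⟨x, hx, hxg⟩
      obtain ⟨y, hy, hyx⟩ := (hρ₁ X hX x).1 hx
      exact ⟨y, hy, Setoid.trans' _ ((m.isExt.stable_iff _ _).2 hyx) hxg⟩
    · rintro ⟨y, hy, hyg⟩
      exact ⟨ρ₁ y, (hρ₁ X hX _).2 ⟨y, hy, Setoid.refl' _ _⟩, hyg⟩

lemma Chain.isSat_lift (f : Chain T T') {X : Set T'.G} (hX : IsSat T'.stable X) :
    IsSat T.stable (f.lift X) := by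
  induction f with
  | refl T => exact hX
  | up m f ih => exact fun x y hxy hx => ih hX ((m.isExt.stable_iff x y).2 hxy) hx
  | down m f _ => exact fun x y hxy ⟨z, hz, hzx⟩ => ⟨z, hz, Setoid.trans' _ hzx hxy⟩

lemma Chain.disjoint_lift (f : Chain T T') {X : Set T'.G} (hX : Disjoint X T'.zeroTribe) :
    Disjoint (f.lift X) T.zeroTribe := by
  induction f with
  | refl T => exact hX
  | up m f ih =>
    have ih' := Set.disjoint_left.1 (ih hX)
    exact Set.disjoint_left.2 fun x hx hx' => ih' hx ((m.isExt.mem_zeroTribe x).2 hx')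
  | @down T _ _ m f ih =>
    have ih' := Set.disjoint_left.1 (ih hX)
    rw [Set.disjoint_left]
    rintro x ⟨z, hz, hzx⟩ hx
    exact ih' hz ((m.isExt.mem_zeroTribe z).1 (T.isSat_zeroTribe (Setoid.symm' _ hzx) hx))

/-- The lift of a set of tribes that is invariant under automorphisms does not depend on the
chain, and is compatible with elementary extensions. -/
theorem IsExt.lift_eq {T₁ : BasedMatrix H} {ι : T.G → T₁.G} (h : IsExt T T₁ ι) (f : Chain T T')
    (f₁ : Chain T₁ T') (hp : T'.IsPrimitive) {X : Set T'.G} (hX : IsSat T'.stable X)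
    (hX' : ∀ (φ : Iso T' T') x, φ.toEquiv x ∈ X ↔ x ∈ X) : f.lift X = ι ⁻¹' f₁.lift X := by
  obtain ⟨ρ, hρ, h1⟩ := f.exists_red hp
  obtain ⟨ρ₁, hρ₁, h2⟩ := f₁.exists_red hp
  obtain ⟨e, he⟩ := hρ₁.confluence hp (Red.step h hρ) hp
  ext g
  rw [h1 X hX, Set.mem_preimage, h2 X hX]
  constructor
  · rintro ⟨x, hx, hxg⟩
    exact ⟨e.toEquiv x, (hX' e x).2 hx, Setoid.trans' _ (he x) ((h.stable_iff _ _).2 hxg)⟩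
  · rintro ⟨x, hx, hxg⟩
    obtain ⟨y, rfl⟩ := e.toEquiv.surjective x
    exact ⟨y, (hX' e y).1 hx, (h.stable_iff _ _).1 (Setoid.trans' _ (Setoid.symm' _ (he y)) hxg)⟩

/-! ### Homology classes -/

lemma Homologous.refl (T : BasedMatrix H) : T.Homologous T := ⟨.refl T⟩

lemma Homologous.trans (h : T.Homologous T') (h' : T'.Homologous T'') : T.Homologous T'' := by
  obtain ⟨f⟩ := h
  induction f with
  | refl T => exact h'
  | up m f ih => obtain ⟨g⟩ := ih h'; exact ⟨.up m g⟩
  | down m f ih => obtain ⟨g⟩ := ih h'; exact ⟨.down m g⟩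

lemma Homologous.symm (h : T.Homologous T') : T'.Homologous T := by
  obtain ⟨f⟩ := h
  induction f with
  | refl T => exact ⟨.refl T⟩
  | up m f ih => exact ih.trans ⟨.down m (.refl _)⟩
  | down m f ih => exact ih.trans ⟨.up m (.refl _)⟩

lemma IsExt.homologous {ι : T.G → T'.G} (h : IsExt T T' ι) : T.Homologous T' := by
  rcases h.compl with h' | h'
  · -- an isomorphism is the composition of two extensions by one annihilating element
    rw [Set.compl_empty_iff] at h'
    have hr : (Set.range ((some : T'.G → T'.adjoinAnnihilating.G) ∘ ι))ᶜ =
        (Set.range (some : T'.G → T'.adjoinAnnihilating.G))ᶜ := by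
      rw [Set.range_comp, h', Set.image_univ]
    have hn : T'.adjoinAnnihilating.Removable
        (Set.range (some : T'.G → T'.adjoinAnnihilating.G))ᶜ :=
      T'.isExt_adjoin.compl.resolve_left fun h => by
        rw [Set.compl_empty_iff] at h
        obtain ⟨x, hx⟩ := h.ge (Set.mem_univ (none : Option T'.G))
        exact Option.some_ne_none x hx
    exact ⟨.up (Op.ofEmb _ (h.toIsEmb.comp T'.isExt_adjoin.toIsEmb) (hr ▸ hn))
      (.down (Op.ofEmb _ T'.isExt_adjoin.toIsEmb hn) (.refl _))⟩
  · exact ⟨.up (Op.ofEmb ι h.toIsEmb h') (.refl _)⟩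

/-- Homologous primitive based matrices are isomorphic. -/
theorem Homologous.nonempty_iso (h : T.Homologous T') (hp : T.IsPrimitive) (hp' : T'.IsPrimitive) :
    Nonempty (Iso T T') := by
  obtain ⟨f⟩ := h
  obtain ⟨ρ, hρ, -⟩ := f.exists_red hp'
  obtain ⟨e, -⟩ := hρ.exists_iso hp
  exact ⟨e.symm⟩

theorem exists_isPrimitive_homologous (T : BasedMatrix H) :
    ∃ T' : BasedMatrix H, T'.IsPrimitive ∧ T.Homologous T' := by
  induction hn : Fintype.card T.G using Nat.strong_induction_on generalizing T with
  | _ n ih =>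
    by_cases hp : T.IsPrimitive
    · exact ⟨T, hp, Homologous.refl T⟩
    · rw [isPrimitive_iff] at hp
      push Not at hp
      obtain ⟨N, hN⟩ := hp
      have hs := hN.s_notMem
      have hlt : Fintype.card (T.delete N hs).G < n := by
        obtain ⟨x, hx⟩ : N.Nonempty := by
          rcases hN with ⟨g, -, rfl⟩ | ⟨g, -, rfl⟩ | ⟨g, g', -, rfl⟩ <;> simp
        rw [← hn]
        exact Fintype.card_lt_of_injective_of_notMem _ (T.isEmb_delete N hs).inj
          (b := x) (by rintro ⟨y, rfl⟩; exact y.2 hx)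
      obtain ⟨T', hp', h'⟩ := ih _ hlt _ rfl
      have hc : (Set.range (Subtype.val : {x : T.G // x ∉ N} → T.G))ᶜ = N := by
        rw [range_delete, compl_compl]
      exact ⟨T', hp', Homologous.trans
        ⟨.down (Op.ofEmb _ (T.isEmb_delete N hs) (hc.symm ▸ hN)) (.refl _)⟩ h'⟩

/-! ### The coefficient group -/

lemma stable_le_barPartition (T : BasedMatrix H) : T.stable ≤ T.barPartition :=
  le_sInf fun _ hr => hr.1

lemma barPartition_iso (φ : Iso T T) (x : T.G) : T.barPartition x (φ.toEquiv x) :=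
  fun _ hr => hr.2 φ x

lemma barPartition_map (e : Iso T T') {x y : T.G} (h : T.barPartition x y) :
    T'.barPartition (e.toEquiv x) (e.toEquiv y) := by
  rintro r ⟨h1, h2⟩
  refine h (Setoid.comap e.toEquiv r) ⟨fun a b hab => h1 ((e.isExt.stable_iff a b).2 hab),
    fun φ a => ?_⟩
  have := h2 ((e.symm.trans φ).trans e) (e.toEquiv a)
  simpa [Iso.trans, Iso.symm, Setoid.comap_rel] using this

lemma barPartition_map_iff (e : Iso T T') (x y : T.G) :
    T'.barPartition (e.toEquiv x) (e.toEquiv y) ↔ T.barPartition x y := by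
  refine ⟨fun h => ?_, barPartition_map e⟩
  simpa [Iso.symm] using barPartition_map e.symm h

lemma isSat_of_mem_classes {r : Setoid T.G} (hr : T.stable ≤ r) {C : Set T.G} (hC : C ∈ r.classes) :
    IsSat T.stable C := by
  obtain ⟨c, rfl⟩ := hC
  exact fun x y hxy hx => r.trans (r.symm (hr hxy)) hx

lemma BarClass.isSat (C : T.BarClass) : IsSat T.stable C.1 :=
  isSat_of_mem_classes T.stable_le_barPartition C.2.1

lemma BarClass.iso_mem_iff (C : T.BarClass) (φ : Iso T T) (x : T.G) :
    φ.toEquiv x ∈ C.1 ↔ x ∈ C.1 := by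
  obtain ⟨C, ⟨c, rfl⟩, h⟩ := C
  have := barPartition_iso φ x
  exact ⟨fun h => Setoid.trans' _ this h, fun h => Setoid.trans' _ (Setoid.symm' _ this) h⟩

lemma barClass_preimage (e : Iso T T') {C : Set T'.G}
    (hC : C ∈ T'.barPartition.classes ∧ Disjoint C T'.zeroTribe) :
    e.toEquiv ⁻¹' C ∈ T.barPartition.classes ∧ Disjoint (e.toEquiv ⁻¹' C) T.zeroTribe := by
  obtain ⟨⟨c, rfl⟩, h⟩ := hC
  refine ⟨⟨e.toEquiv.symm c, ?_⟩, ?_⟩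
  · ext x
    rw [Set.mem_ofPred_eq, ← barPartition_map_iff e, Equiv.apply_symm_apply]; rfl
  · rw [Set.disjoint_left] at h ⊢
    exact fun x hx hx' => h hx ((e.isExt.mem_zeroTribe x).2 hx')

/-- The bijection between the classes that index the coefficient groups of isomorphic matrices. -/
def barClassEquiv (e : Iso T T') : T'.BarClass ≃ T.BarClass where
  toFun C := ⟨e.toEquiv ⁻¹' C.1, barClass_preimage e C.2⟩
  invFun C := ⟨e.symm.toEquiv ⁻¹' C.1, barClass_preimage e.symm C.2⟩
  left_inv C := Subtype.ext (e.toEquiv.symm_preimage_preimage C.1)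
  right_inv C := Subtype.ext (e.toEquiv.preimage_symm_preimage C.1)

theorem Iso.nonempty_coeffGroup (e : Iso T T') : Nonempty (T.CoeffGroup ≃+ T'.CoeffGroup) := by
  let E : (T.BarClass → H) ≃+ (T'.BarClass → H) :=
    { toFun := fun f C => f (barClassEquiv e C)
      invFun := fun f C => f ((barClassEquiv e).symm C)
      left_inv := fun f => by ext; simp
      right_inv := fun f => by ext; simp
      map_add' := fun f g => rfl }
  have hE : E T.barS = T'.barS := by
    ext C
    change T.rowSum T.s (e.toEquiv ⁻¹' C.1) = T'.rowSum T'.s C.1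
    rw [← e.map_s, e.isEmb.rowSum_eq, e.toEquiv.surjective.range_eq, Set.compl_univ,
      Set.inter_empty, rowSum_empty, add_zero]
  exact ⟨QuotientAddGroup.congr _ _ E (by
    rw [← hE]; exact AddMonoidHom.map_zmultiples E.toAddMonoidHom _)⟩

end BasedMatrix

namespace BasedMatrix

universe u
variable {H : Type u} [AddCommGroup H] {T T' T₁ : BasedMatrix H}

/-! ### Invariance of the reduced stable parity -/

/-- The coefficient `b (g, χ_X) - ⌊|X| / 2⌋ b (g, s)` of the reduced stable parity. -/
def reducedValue (T : BasedMatrix H) (g : T.G) (X : Set T.G) : H :=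
  T.rowSum g X - (X.ncard / 2) • T.b g T.s

/-- An elementary extension adds `m` complementary pairs to a set of tribes outside the zero
tribe; each pair contributes `b (g, s)` to the row of `g`. -/
lemma IsExt.exists_rowSum_new {ι : T.G → T'.G} (h : IsExt T T' ι) {X : Set T'.G}
    (hX : IsSat T'.stable X) (hX0 : Disjoint X T'.zeroTribe) :
    ∃ m : ℕ, X.ncard = (ι ⁻¹' X).ncard + 2 * m ∧
      ∀ g, T'.rowSum g (X ∩ (Set.range ι)ᶜ) = m • T'.b g T'.s := by
  have hcard : X.ncard = (ι ⁻¹' X).ncard + (X ∩ (Set.range ι)ᶜ).ncard := by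
    rw [← Set.ncard_image_of_injective (ι ⁻¹' X) h.inj, Set.image_preimage_eq_inter_range,
      ← Set.ncard_inter_add_ncard_sdiff_eq_ncard X (Set.range ι) (Set.toFinite _), Set.sdiff_eq]
  rw [hcard]
  by_cases hne : X ∩ (Set.range ι)ᶜ = ∅
  · exact ⟨0, by rw [hne]; simp, fun g => by rw [hne, rowSum_empty, zero_smul]⟩
  · obtain ⟨x, hx, hx'⟩ := Set.nonempty_iff_ne_empty.2 hne
    have h1 : X ∩ (Set.range ι)ᶜ = (Set.range ι)ᶜ :=
      Set.inter_eq_right.2 fun y hy => hX (h.stable_new hx' hy) hx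
    rw [Set.disjoint_left] at hX0
    rcases h.compl with h | ⟨g, hg, h⟩ | ⟨g, hg, h⟩ | ⟨g, g', hg, h⟩ <;> rw [h1]
    · exact absurd (h ▸ hx') (Set.notMem_empty _)
    · rw [h, Set.mem_singleton_iff] at hx'
      exact absurd hg.mem_zeroTribe (hX0 (hx' ▸ hx))
    · rw [h, Set.mem_singleton_iff] at hx'
      exact absurd hg.mem_zeroTribe (hX0 (hx' ▸ hx))
    · exact ⟨1, by rw [h, Set.ncard_pair hg.2.2.1],
        fun y => by rw [h, rowSum_pair _ _ hg.2.2.1, hg.b_right, one_smul]⟩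

lemma IsExt.reducedValue_eq {ι : T.G → T'.G} (h : IsExt T T' ι) {X : Set T'.G}
    (hX : IsSat T'.stable X) (hX0 : Disjoint X T'.zeroTribe) (g : T.G) :
    T'.reducedValue (ι g) X = T.reducedValue g (ι ⁻¹' X) := by
  obtain ⟨m, hm, h1⟩ := h.exists_rowSum_new hX hX0
  rw [reducedValue, reducedValue, hm, h.rowSum_eq, h1, ← h.map_s, h.map_b,
    Nat.add_mul_div_left _ _ two_pos, add_smul]
  abel

/-- Elementary extensions preserve the reduced stable parity. For the identity this says that the
parity does not depend on the chain. -/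
theorem IsExt.reducedParity_eq {ι : T.G → T₁.G} (h : IsExt T T₁ ι) (f : Chain T T')
    (f₁ : Chain T₁ T') (hp : T'.IsPrimitive) (g : T.G) :
    f₁.reducedParity (ι g) = f.reducedParity g := by
  refine congrArg QuotientAddGroup.mk (funext fun C => ?_)
  change T₁.reducedValue (ι g) (f₁.lift C.1) = T.reducedValue g (f.lift C.1)
  rw [h.reducedValue_eq (f₁.isSat_lift C.isSat) (f₁.disjoint_lift C.2.2),
    h.lift_eq f f₁ hp C.isSat fun φ x => C.iso_mem_iff φ x]

lemma IsExt.rowSum_s {ι : T.G → T'.G} (h : IsExt T T' ι) (hs : T.b T.s T.s = 0) {X : Set T'.G}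
    (hX : IsSat T'.stable X) : T'.rowSum T'.s X = T.rowSum T.s (ι ⁻¹' X) := by
  obtain ⟨m, hm⟩ := h.rowSum_new fun x y hx hy hx' => hX (h.stable_new hx hy) hx'
  rw [← h.map_s, h.rowSum_eq, hm, ← h.map_s, h.map_b, hs, smul_zero, add_zero]

theorem Chain.rowSum_s (f : Chain T T') (hs : T.b T.s T.s = 0) {X : Set T'.G}
    (hX : IsSat T'.stable X) : T.rowSum T.s (f.lift X) = T'.rowSum T'.s X := by
  induction f with
  | refl T => rfl
  | up m f ih =>
    rw [← ih (by rw [← m.isExt.map_s, m.isExt.map_b, hs]) hX]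
    exact (m.isExt.rowSum_s hs (f.isSat_lift hX)).symm
  | @down T T₁ _ m f ih =>
    have hs₁ : T₁.b T₁.s T₁.s = 0 := by rw [← hs, ← m.isExt.map_s, m.isExt.map_b]
    rw [← ih hs₁ hX, m.isExt.rowSum_s hs₁ ((Chain.down m f).isSat_lift hX)]
    congr 1
    ext x
    constructor
    · rintro ⟨y, hy, hyx⟩
      exact f.isSat_lift hX ((m.isExt.stable_iff _ _).1 hyx) hy
    · exact fun hx => ⟨x, hx, Setoid.refl' _ _⟩

/-- A linear relation between rows, modulo the row of `s`, is a relation between the values of the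
reduced stable parity, since the values of the row of `s` form the element `b̄(s)`. -/
theorem Chain.reducedParity_relation (f : Chain T T') (hs : T.b T.s T.s = 0) {ι : Type*}
    (I : Finset ι) (m : ι → ℤ) (g : ι → T.G) (k : ℤ)
    (h : ∀ x, ∑ i ∈ I, m i • T.b (g i) x = k • T.b T.s x) :
    ∑ i ∈ I, m i • f.reducedParity (g i) = 0 := by
  have h1 : ∑ i ∈ I, m i • f.reducedParity (g i) =
      QuotientAddGroup.mk' (AddSubgroup.zmultiples T'.barS)
        (∑ i ∈ I, m i • fun C : T'.BarClass => T.reducedValue (g i) (f.lift C.1)) := by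
    rw [map_sum]
    exact Finset.sum_congr rfl fun i _ => by rw [map_zsmul]; rfl
  rw [h1, QuotientAddGroup.mk'_apply, QuotientAddGroup.eq_zero_iff, AddSubgroup.mem_zmultiples_iff]
  refine ⟨k, funext fun C => ?_⟩
  rw [Finset.sum_apply]
  simp only [Pi.smul_apply, reducedValue, smul_sub, Finset.sum_sub_distrib]
  rw [T.rowSum_relation I m g k h, f.rowSum_s hs C.isSat]
  have h2 : ∑ i ∈ I, m i • ((f.lift C.1).ncard / 2) • T.b (g i) T.s = 0 := by
    rw [Finset.sum_congr rfl fun i _ => smul_comm (m i) ((f.lift C.1).ncard / 2) (T.b (g i) T.s),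
      ← Finset.smul_sum, h, hs, smul_zero, smul_zero]
  rw [h2, sub_zero]
  rfl

lemma CoeffGroup.neg_eq {R : Type*} [CommRing R] (h : (2 : R) = 0) (T : BasedMatrix R)
    (a : T.CoeffGroup) : -a = a := by
  obtain ⟨x, rfl⟩ := QuotientAddGroup.mk_surjective a
  refine congrArg QuotientAddGroup.mk (funext fun C => ?_)
  rw [Pi.neg_apply, neg_eq_iff_add_eq_zero, ← two_mul, h, zero_mul]

end BasedMatrix

namespace Diagram

variable {κ : KnotKind} {R : Type*} [CommRing R]

/-! ### Cycles and their jumps -/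

/-- The difference of the coefficients of the cycle `D.cycle R g` on the outgoing and on the
incoming edge of a passage: the left half at `c` begins at `(c, true)` and ends at `(c, false)`. -/
def jump (R : Type*) [CommRing R] {V : Type} : Option V → V × Bool → R
  | none => 0
  | some c => open Classical in Pi.single (c, true) 1 - Pi.single (c, false) 1

lemma jump_of_ne {V : Type} {c : V} {p : V × Bool} (h : p.1 ≠ c) : jump R (some c) p = 0 := by
  classical
  simp [jump, Prod.ext_iff, h]

lemma jump_map {V V' : Type} {f : V → V'} (hf : Function.Injective f) (g : Option V)
    (p : V × Bool) : jump R (g.map f) (Prod.map f id p) = jump R g p := by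
  classical
  cases g <;> simp [jump, Pi.single_apply, Prod.ext_iff, hf.eq_iff]

lemma jump_closed {V : Type} (g : Option V) (v : V) :
    jump R g (v, false) + jump R g (v, true) = 0 := by
  classical
  cases g with
  | none => simp [jump]
  | some c => by_cases h : v = c <;> simp [jump, h]

lemma cycle_jump (D : Diagram κ) (g : Option D.V) (p : D.V × Bool) :
    D.cycle R g p - D.cycle R g (D.next.symm p) = jump R g p := by
  classical
  cases g with
  | none => simp [cycle, jump]
  | some c =>
    by_cases h : p.1 = c
    · obtain ⟨v, e⟩ := p
      obtain rfl : v = c := h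
      cases e
      · simp [cycle, jump, D.notMem_leftHalf_false, D.prev_false_mem]
      · simp [cycle, jump, D.prev_true_notMem, D.mem_leftHalf_true]
    · have h1 : p ∈ D.leftHalf c ↔ D.next.symm p ∈ D.leftHalf c :=
        ⟨D.prev_mem_leftHalf c p fun h' => h (by rw [h']),
          D.mem_leftHalf_of_prev c p fun h' => h (by rw [h'])⟩
      rw [jump_of_ne h]
      simp [cycle, Set.indicator, h1]

lemma cycle_eq_prev (D : Diagram κ) {c : D.V} {p : D.V × Bool} (h : p.1 ≠ c) :
    D.cycle R (some c) p = D.cycle R (some c) (D.next.symm p) := by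
  rw [← sub_eq_zero, cycle_jump, jump_of_ne h]

@[simp] lemma cycle_true (D : Diagram κ) (c : D.V) : D.cycle R (some c) (c, true) = 1 := by
  simp [cycle, D.mem_leftHalf_true]

@[simp] lemma cycle_false (D : Diagram κ) (c : D.V) : D.cycle R (some c) (c, false) = 0 := by
  simp [cycle, D.notMem_leftHalf_false]

lemma eq_of_next_eq {A : Type*} (D : Diagram κ) {x : D.V × Bool → A}
    (h : ∀ p, x p = x (D.next.symm p))
    (p q : D.V × Bool) : x p = x q := by
  obtain ⟨k, rfl⟩ := D.cyclic p q
  induction k with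
  | zero => rfl
  | succ k ih => rw [Function.iterate_succ_apply', h (D.next _), Equiv.symm_apply_apply, ih]

/-- Chains with equal jumps that agree on one edge are equal. -/
lemma eq_of_jump (D : Diagram κ) {x y : D.V × Bool → R}
    (h : ∀ p, x p - x (D.next.symm p) = y p - y (D.next.symm p)) (q : D.V × Bool)
    (hq : x q = y q) : x = y := by
  funext p
  have := D.eq_of_next_eq (x := fun p => x p - y p) (fun p => by linear_combination h p) p q
  linear_combination this + hq

lemma cycle_eq (D : Diagram κ) {c : D.V} {x : D.V × Bool → R}
    (h : ∀ p, x p - x (D.next.symm p) = jump R (some c) p) (h1 : x (c, true) = 1) :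
    x = D.cycle R (some c) :=
  D.eq_of_jump (fun p => by rw [h, cycle_jump]) (c, true) (by rw [h1, cycle_true])

open Classical in
lemma single_prev (D : Diagram κ) (q p : D.V × Bool) :
    (Pi.single q 1 : D.V × Bool → R) (D.next.symm p) = (Pi.single (D.next q) 1 : _ → R) p := by
  simp [Pi.single_apply, Equiv.symm_apply_eq]

/-! ### Intersection numbers -/

lemma inter_add (D : Diagram κ) (x x' y : D.V × Bool → R) :
    D.inter (x + x') y = D.inter x y + D.inter x' y := by
  simp only [inter, ← Finset.sum_add_distrib, Pi.add_apply]
  exact Finset.sum_congr rfl fun v _ => by ring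

lemma inter_smul (D : Diagram κ) (a : ℤ) (x y : D.V × Bool → R) :
    D.inter (a • x) y = a • D.inter x y := by
  simp only [inter, Finset.smul_sum, Pi.smul_apply, zsmul_eq_mul]
  exact Finset.sum_congr rfl fun v _ => by ring

lemma inter_sub (D : Diagram κ) (x x' y : D.V × Bool → R) :
    D.inter (x - x') y = D.inter x y - D.inter x' y := by
  rw [sub_eq_add_neg, inter_add, ← neg_one_zsmul, inter_smul, neg_one_zsmul, ← sub_eq_add_neg]

lemma inter_sum (D : Diagram κ) {ι : Type*} (I : Finset ι) (x : ι → D.V × Bool → R)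
    (y : D.V × Bool → R) : D.inter (∑ i ∈ I, x i) y = ∑ i ∈ I, D.inter (x i) y := by
  classical
  induction I using Finset.induction_on with
  | empty => simp [inter]
  | insert i I hi ih => rw [Finset.sum_insert hi, Finset.sum_insert hi, inter_add, ih]

/-- The intersection number of one edge with a cycle. -/
lemma inter_single (D : Diagram κ) (q : D.V × Bool) (y : D.V × Bool → R) :
    open Classical in D.inter (Pi.single q 1) y =
      (if (D.next q).2 = false then y (D.next.symm ((D.next q).1, true)) else 0) -
        if q.2 = true then y (q.1, false) else 0 := by
  classical
  rw [inter, Finset.sum_sub_distrib]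
  congr 1
  · rw [Finset.sum_eq_single (D.next q).1]
    · rw [single_prev]
      rcases h : D.next q with ⟨w, e⟩
      cases e <;> simp
    · intro v _ hv
      rw [single_prev, Pi.single_eq_of_ne, zero_mul]
      exact fun h => hv (by rw [← h])
    · simp
  · rw [Finset.sum_eq_single q.1]
    · rcases q with ⟨w, e⟩
      cases e <;> simp
    · intro v _ hv
      rw [Pi.single_eq_of_ne, zero_mul]
      exact fun h => hv (by rw [← h])
    · simp

lemma basedMatrix_b (D : Diagram κ) (g h : Option D.V) :
    (D.basedMatrix R).b g h = D.inter (D.cycle R g) (D.cycle R h) := rfl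

lemma basedMatrix_s (D : Diagram κ) : (D.basedMatrix R).s = none := rfl

lemma basedMatrix_b_s (D : Diagram κ) :
    (D.basedMatrix R).b (D.basedMatrix R).s (D.basedMatrix R).s = 0 := by
  rw [basedMatrix_s, basedMatrix_b]
  simp [inter, cycle]

/-! ### Insertion of crossings -/

section Insertion

variable {D D' : Diagram κ}

/-- For coefficients that do not change at the new crossings, the edge of `D'` that enters an old
passage carries the same coefficient as the one that leaves the preceding old passage. -/
lemma Insertion.prev_eq {A : Type*} (m : Insertion D D') {x : D'.V × Bool → A}
    (hx : ∀ q, q.1 ∉ Set.range m.ι → x q = x (D'.next.symm q)) (p : D.V × Bool) :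
    x (D'.next.symm (Prod.map m.ι id p)) = x (Prod.map m.ι id (D.next.symm p)) := by
  obtain ⟨k, hk, hk'⟩ := m.next_eq (D.next.symm p)
  rw [Equiv.apply_symm_apply] at hk
  have h : ∀ j ≤ k, x (D'.next^[j] (Prod.map m.ι id (D.next.symm p))) =
      x (Prod.map m.ι id (D.next.symm p)) := by
    intro j hj
    induction j with
    | zero => rfl
    | succ j ih =>
      rw [← ih (by omega), hx _ (hk' j (by omega)), Function.iterate_succ_apply',
        Equiv.symm_apply_apply]
  rw [← hk, Function.iterate_succ_apply', Equiv.symm_apply_apply, h k le_rfl]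

lemma Insertion.cycle_map_prev (m : Insertion D D') (g : Option D.V) {q : D'.V × Bool}
    (hq : q.1 ∉ Set.range m.ι) :
    D'.cycle R (g.map m.ι) q = D'.cycle R (g.map m.ι) (D'.next.symm q) := by
  cases g with
  | none => rfl
  | some c => exact D'.cycle_eq_prev fun h => hq ⟨c, h.symm⟩

/-- The halves at the old crossings are not affected by the insertion of crossings. -/
lemma Insertion.cycle_map (m : Insertion D D') (g : Option D.V) (p : D.V × Bool) :
    D'.cycle R (g.map m.ι) (Prod.map m.ι id p) = D.cycle R g p := by
  have h := fun q => m.prev_eq (x := D'.cycle R (g.map m.ι)) (fun q => m.cycle_map_prev g) q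
  cases g with
  | none => rfl
  | some c =>
    refine congrFun (D.cycle_eq
      (x := fun p => D'.cycle R (some (m.ι c)) (Prod.map m.ι id p)) ?_ ?_) p
    · intro p
      have h := h p
      rw [Option.map_some] at h
      rw [← h, cycle_jump, ← jump_map m.ι.injective (some c), Option.map_some]
    · exact D'.cycle_true _

lemma Insertion.b_map [DecidableEq D'.V] (m : Insertion D D') (g h : Option D.V) :
    (D'.basedMatrix R).b (g.map m.ι) (h.map m.ι) = (D.basedMatrix R).b g h +
      ∑ v ∈ (Finset.univ.map m.ι)ᶜ,
        (D'.cycle R (g.map m.ι) (v, false) * D'.cycle R (h.map m.ι) (v, true) -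
          D'.cycle R (g.map m.ι) (v, true) * D'.cycle R (h.map m.ι) (v, false)) := by
  rw [basedMatrix_b, basedMatrix_b, inter, ← Finset.sum_add_sum_compl (Finset.univ.map m.ι),
    Finset.sum_map]
  congr 1
  · refine Finset.sum_congr rfl fun v _ => ?_
    have key := fun (g : Option D.V) (e : Bool) =>
      (m.prev_eq (fun q => m.cycle_map_prev g) (v, e)).trans
      (m.cycle_map (R := R) g _)
    have key' := fun (g : Option D.V) (e : Bool) => m.cycle_map (R := R) g (v, e)
    simp only [Prod.map_apply, id] at key key'
    rw [key, key, key', key']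
  · refine Finset.sum_congr rfl fun v hv => ?_
    have hv' : v ∉ Set.range m.ι := by simpa using hv
    rw [← m.cycle_map_prev g (q := (v, false)) hv', ← m.cycle_map_prev h (q := (v, true)) hv']

/-- An insertion embeds the based matrices if the new crossings do not contribute to intersection
numbers of chains whose coefficients do not change there. -/
lemma Insertion.isEmb [DecidableEq D'.V] (m : Insertion D D')
    (hm : ∀ x y : D'.V × Bool → R, (∀ q, q.1 ∉ Set.range m.ι → x q = x (D'.next.symm q)) →
      (∀ q, q.1 ∉ Set.range m.ι → y q = y (D'.next.symm q)) →
      ∑ v ∈ (Finset.univ.map m.ι)ᶜ, (x (v, false) * y (v, true) - x (v, true) * y (v, false)) = 0) :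
    BasedMatrix.IsEmb (D.basedMatrix R) (D'.basedMatrix R) (Option.map m.ι) :=
  ⟨Option.map_injective m.ι.injective, rfl, fun g h => by
    refine (m.b_map g h).trans ?_
    rw [hm _ _ (fun q => m.cycle_map_prev g) (fun q => m.cycle_map_prev h), add_zero]⟩

lemma compl_range_map {V V' : Type} (f : V → V') :
    (Set.range (Option.map f))ᶜ = some '' (Set.range f)ᶜ := by
  ext x; cases x <;> simp

/-- An isotopy induces an isomorphism of based matrices. -/
lemma Isotopy.isExt (m : Isotopy D D') :
    BasedMatrix.IsExt (D.basedMatrix R) (D'.basedMatrix R) (Option.map m.e) := by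
  classical
  let m' : Insertion D D' := ⟨m.e.toEmbedding, fun p => ⟨0, m.next_eq p, by simp⟩, m.info_eq⟩
  refine ⟨m'.isEmb fun x y _ _ => ?_, Or.inl ?_⟩
  · rw [show (Finset.univ.map m'.ι)ᶜ = ∅ by simp [m'], Finset.sum_empty]
  · exact (compl_range_map m.e).trans (by simp; rfl)

/-- One half at the new crossing is the loop, which meets no cycle. Hence the left half is
annihilating if it is the loop, and core otherwise. -/
lemma MoveR1.annihilating_or_core (m : MoveR1 D D') :
    (D'.basedMatrix R).Annihilating (some m.c) ∨ (D'.basedMatrix R).Core (some m.c) := by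
  classical
  have hne : (some m.c : Option D'.V) ≠ none := Option.some_ne_none _
  obtain ⟨β, hβ⟩ := m.loop
  cases β
  · right
    have hc : (1 - Pi.single (m.c, false) 1 : D'.V × Bool → R) = D'.cycle R (some m.c) := by
      refine D'.cycle_eq (fun p => ?_) (by simp)
      simp only [Pi.sub_apply, Pi.one_apply, single_prev, hβ, jump]
      simp only [Bool.not_false]; ring
    refine ⟨hne, fun (h : Option D'.V) => ?_⟩
    change D'.inter (D'.cycle R (some m.c)) (D'.cycle R h) = D'.inter 1 (D'.cycle R h)
    rw [← hc, inter_sub, inter_single, hβ]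
    simp
  · left
    have hc : (Pi.single (m.c, true) 1 : D'.V × Bool → R) = D'.cycle R (some m.c) := by
      refine D'.cycle_eq (fun p => ?_) (by simp)
      simp only [single_prev, hβ, jump, Pi.sub_apply, Bool.not_true]
    refine ⟨hne, fun (h : Option D'.V) => ?_⟩
    change D'.inter (D'.cycle R (some m.c)) (D'.cycle R h) = 0
    rw [← hc, inter_single, hβ]
    have h1 := D'.cycle_closed (R := R) h m.c
    rw [← show D'.next (m.c, true) = (m.c, false) from hβ, Equiv.symm_apply_apply] at h1
    simp only [Bool.not_true, if_true]
    rw [← show D'.next (m.c, true) = (m.c, false) from hβ]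
    linear_combination -h1

/-- A first Reidemeister move adds an annihilating or a core element. -/
lemma MoveR1.isExt (m : MoveR1 D D') :
    BasedMatrix.IsExt (D.basedMatrix R) (D'.basedMatrix R) (Option.map m.ι) := by
  classical
  have hN : (Set.range m.ι)ᶜ = {m.c} := Set.ext fun v => m.new v
  refine ⟨m.toInsertion.isEmb fun x y hx hy => ?_, Or.inr ?_⟩
  · rw [show (Finset.univ.map m.ι)ᶜ = {m.c} by ext v; simpa using m.new v, Finset.sum_singleton]
    have hc : m.c ∉ Set.range m.ι := (m.new _).2 rfl
    obtain ⟨β, hβ⟩ := m.loop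
    -- both passages through the new crossing have the coefficient of the loop
    have key : ∀ z : D'.V × Bool → R, (∀ q, q.1 ∉ Set.range m.ι → z q = z (D'.next.symm q)) →
        z (m.c, true) = z (m.c, false) := by
      intro z hz
      have := hz (m.c, !β) hc
      rw [← hβ, Equiv.symm_apply_apply, hβ] at this
      cases β
      · exact this
      · exact this.symm
    rw [key x hx, key y hy, sub_self]
  · have hr : (Set.range (Option.map m.ι))ᶜ = {some m.c} :=
      (compl_range_map m.ι).trans (by rw [hN]; exact Set.image_singleton)
    exact m.annihilating_or_core.imp (fun h => ⟨_, h, hr⟩) fun h => Or.inl ⟨_, h, hr⟩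

/-- The two halves at the corners of a bigon add up to the whole diagram and to the boundary of the
bigon, whose intersection number with all cycles is zero. -/
lemma MoveR2.complementary (m : MoveR2 D D') :
    (D'.basedMatrix R).Complementary (some m.c) (some m.c') := by
  classical
  refine ⟨Option.some_ne_none _, Option.some_ne_none _, fun h => m.ne (Option.some_injective _ h),
    fun (h : Option D'.V) => ?_⟩
  change D'.inter (D'.cycle R (some m.c)) (D'.cycle R h) +
    D'.inter (D'.cycle R (some m.c')) (D'.cycle R h) = D'.inter 1 (D'.cycle R h)
  rw [← inter_add]
  have hne := m.ne
  have hne' := m.ne.symm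
  have key : ∀ z : D'.V × Bool → R, (∀ p, z p - z (D'.next.symm p) =
      jump R (some m.c) p + jump R (some m.c') p) → ∀ q,
      z q = D'.cycle R (some m.c) q + D'.cycle R (some m.c') q →
      D'.cycle R (some m.c) + D'.cycle R (some m.c') = z := fun z hz q hq =>
    D'.eq_of_jump (fun p => by
      rw [hz, ← cycle_jump, ← cycle_jump, Pi.add_apply, Pi.add_apply]; ring) q hq.symm
  have hc := D'.cycle_closed (R := R) h m.c
  have hc' := D'.cycle_closed (R := R) h m.c'
  have hprev : ∀ q, D'.cycle R (some m.c') (D'.next.symm q) =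
      D'.cycle R (some m.c') q - jump R (some m.c') q := fun q => by
    rw [← cycle_jump D' (some m.c') q]; ring
  obtain ⟨β, hβ, hβ' | hβ'⟩ := m.bigon
  · have ht : D'.next (m.c, true) = (m.c', false) := by cases β <;> assumption
    have hf : D'.next (m.c, false) = (m.c', true) := by cases β <;> assumption
    rw [← ht, ← hf, Equiv.symm_apply_apply, Equiv.symm_apply_apply, ht, hf] at hc'
    have hv := hprev (m.c', false)
    rw [← ht, Equiv.symm_apply_apply, ht] at hv
    rw [key (1 + Pi.single (m.c, true) 1 - Pi.single (m.c, false) 1) (fun p => by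
        simp only [Pi.sub_apply, Pi.add_apply, Pi.one_apply, single_prev, ht, hf, jump]; ring)
        (m.c, true) (by rw [hv]; simp [jump]),
      inter_sub, inter_add, inter_single, inter_single, ht, hf]
    simp [← hf]
  · cases β
    · simp only [Bool.not_false] at hβ hβ'
      have hv := hprev (m.c', true)
      rw [← hβ, Equiv.symm_apply_apply, hβ] at hv
      rw [key (1 - Pi.single (m.c, false) 1 - Pi.single (m.c', false) 1) (fun p => by
          simp only [Pi.sub_apply, Pi.one_apply, single_prev, hβ, hβ', jump]; ring)
          (m.c, false) (by rw [hv]; simp [jump, hne]),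
        inter_sub, inter_sub, inter_single, inter_single, hβ, hβ']
      simp
    · simp only [Bool.not_true] at hβ hβ'
      have hv := hprev (m.c', false)
      rw [← hβ, Equiv.symm_apply_apply, hβ] at hv
      rw [key (1 + Pi.single (m.c, true) 1 + Pi.single (m.c', true) 1) (fun p => by
          simp only [Pi.add_apply, Pi.one_apply, single_prev, hβ, hβ', jump, Pi.sub_apply]; ring)
          (m.c, true) (by rw [hv]; simp [jump, hne]),
        inter_add, inter_add, inter_single, inter_single, hβ, hβ']
      rw [← hβ', Equiv.symm_apply_apply, hβ'] at hc
      rw [← hβ, Equiv.symm_apply_apply, hβ] at hc'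
      simp only [if_true]
      linear_combination -hc - hc'

/-- A second Reidemeister move adds a pair of complementary elements. -/
lemma MoveR2.isExt (m : MoveR2 D D') :
    BasedMatrix.IsExt (D.basedMatrix R) (D'.basedMatrix R) (Option.map m.ι) := by
  classical
  have hN : (Set.range m.ι)ᶜ = {m.c, m.c'} := Set.ext fun v => m.new v
  refine ⟨m.toInsertion.isEmb fun x y hx hy => ?_, Or.inr ?_⟩
  · rw [show (Finset.univ.map m.ι)ᶜ = {m.c, m.c'} by ext v; simpa using m.new v,
      Finset.sum_pair m.ne]
    have hc : m.c ∉ Set.range m.ι := (m.new _).2 (Or.inl rfl)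
    have hc' : m.c' ∉ Set.range m.ι := (m.new _).2 (Or.inr rfl)
    obtain ⟨β, hβ, hβ'⟩ := m.bigon
    -- the coefficient does not change along a strand, and the strands exchange their labels
    have key : ∀ z : D'.V × Bool → R, (∀ q, q.1 ∉ Set.range m.ι → z q = z (D'.next.symm q)) →
        z (m.c', true) = z (m.c, false) ∧ z (m.c', false) = z (m.c, true) := by
      intro z hz
      have h1 := hz (m.c', !β) hc'
      rw [← hβ, Equiv.symm_apply_apply, hβ] at h1
      have h2 : z (m.c', β) = z (m.c, !β) := by
        rcases hβ' with hβ' | hβ'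
        · have := hz (m.c', β) hc'
          rwa [← hβ', Equiv.symm_apply_apply, hβ'] at this
        · have := hz (m.c, !β) hc
          rw [← hβ', Equiv.symm_apply_apply, hβ'] at this
          exact this.symm
      cases β
      · exact ⟨h1, h2⟩
      · exact ⟨h2, h1⟩
    rw [(key x hx).1, (key x hx).2, (key y hy).1, (key y hy).2]
    ring
  · exact Or.inr (Or.inr ⟨_, _, m.complementary,
      (compl_range_map m.ι).trans (by rw [hN]; exact Set.image_pair _ _ _)⟩)

end Insertion

end Diagram

namespace Diagram

variable {κ : KnotKind} {R : Type*} [CommRing R]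

/-! ### Third Reidemeister moves -/

namespace MoveR3

variable {D D' : Diagram κ} (m : MoveR3 D D')

/-- The end of the side `i` of the triangle at the corner `c i`. -/
def endA (i : Fin 3) : D.V × Bool := (m.c i, !(m.β i))

/-- The end of the side `i` of the triangle at the corner `c (i + 1)`. -/
def endB (i : Fin 3) : D.V × Bool := (m.c (i + 1), m.β (i + 1))

/-- The first end of the side `i` in the direction of the knot. -/
def first (i : Fin 3) : D.V × Bool := if m.t i then m.endA i else m.endB i

/-- The last end of the side `i` in the direction of the knot. -/
def second (i : Fin 3) : D.V × Bool := if m.t i then m.endB i else m.endA i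

lemma next_first (i : Fin 3) : D.next (m.first i) = m.second i := by
  have := m.side i
  cases h : m.t i <;> simpa [first, second, h, endA, endB] using this

lemma prev_second (i : Fin 3) : D.next.symm (m.second i) = m.first i := by
  rw [← next_first, Equiv.symm_apply_apply]

lemma swap_endA (i : Fin 3) : m.swap (m.endA i) = m.endB i := m.swap_first i

lemma swap_endB (i : Fin 3) : m.swap (m.endB i) = m.endA i := m.swap_last i

lemma swap_fst (i : Fin 3) : m.swap (m.first i) = m.second i := by
  cases h : m.t i <;> simp [first, second, h, swap_endA, swap_endB]

lemma swap_second (i : Fin 3) : m.swap (m.second i) = m.first i := by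
  cases h : m.t i <;> simp [first, second, h, swap_endA, swap_endB]

lemma endB_pred (i : Fin 3) : m.endB (i - 1) = (m.c i, m.β i) := by
  rw [endB, sub_add_cancel]

lemma endA_ne_endB (i j : Fin 3) : m.endA i ≠ m.endB j := by
  intro h
  have h1 : i = j + 1 := m.c_inj (congrArg Prod.fst h)
  have h2 := congrArg Prod.snd h
  rw [endA, endB, ← h1] at h2
  simp at h2

lemma endA_inj {i j : Fin 3} (h : m.endA i = m.endA j) : i = j := m.c_inj (congrArg Prod.fst h)

lemma endB_inj {i j : Fin 3} (h : m.endB i = m.endB j) : i = j :=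
  add_right_cancel (m.c_inj (congrArg Prod.fst h))

lemma first_inj {i j : Fin 3} (h : m.first i = m.first j) : i = j := by
  rw [first, first] at h
  split_ifs at h
  exacts [m.endA_inj h, absurd h (m.endA_ne_endB _ _), absurd h.symm (m.endA_ne_endB _ _),
    m.endB_inj h]

lemma second_ne_first (i j : Fin 3) : m.second i ≠ m.first j := by
  intro h
  obtain rfl : i = j := by
    rw [second, first] at h
    split_ifs at h
    exacts [absurd h.symm (m.endA_ne_endB _ _), m.endB_inj h, m.endA_inj h,
      absurd h (m.endA_ne_endB _ _)]
  rw [second, first] at h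
  split_ifs at h
  exacts [m.endA_ne_endB _ _ h.symm, m.endA_ne_endB _ _ h]

lemma prev_first_ne (i j : Fin 3) : D.next.symm (m.first i) ≠ m.first j := fun h =>
  m.second_ne_first j i (by rw [← m.next_first, ← h, Equiv.apply_symm_apply])

lemma first_fst_ne (i : Fin 3) : (m.first i).1 ≠ (m.second i).1 := by
  have h : m.c i ≠ m.c (i + 1) := fun h => by simpa using m.c_inj h
  rw [first, second]
  split_ifs
  exacts [h, h.symm]

lemma exists_first_fst (i : Fin 3) : ∃ k, (m.first i).1 = m.c k := by
  rw [first]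
  split_ifs
  exacts [⟨_, rfl⟩, ⟨_, rfl⟩]

lemma exists_second_fst (i : Fin 3) : ∃ k, (m.second i).1 = m.c k := by
  rw [second]
  split_ifs
  exacts [⟨_, rfl⟩, ⟨_, rfl⟩]

lemma exists_end {p : D.V × Bool} {i : Fin 3} (h : p.1 = m.c i) :
    (∃ j, p = m.first j) ∨ ∃ j, p = m.second j := by
  have h1 : p = m.endA i ∨ p = m.endB (i - 1) := by
    rw [endB_pred, endA]
    obtain ⟨v, e⟩ := p
    obtain rfl : v = m.c i := h
    cases e <;> cases m.β i <;> simp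
  have hA : ∀ j, (m.endA j = m.first j) ∨ m.endA j = m.second j := fun j => by
    rw [first, second]; split_ifs <;> simp
  have hB : ∀ j, (m.endB j = m.first j) ∨ m.endB j = m.second j := fun j => by
    rw [first, second]; split_ifs <;> simp
  rcases h1 with rfl | rfl
  · exact (hA i).imp (fun h => ⟨_, h⟩) fun h => ⟨_, h⟩
  · exact (hB (i - 1)).imp (fun h => ⟨_, h⟩) fun h => ⟨_, h⟩

lemma swap_swap (p : D.V × Bool) : m.swap (m.swap p) = p := by
  by_cases h : ∃ i, p.1 = m.c i
  · obtain ⟨i, hi⟩ := h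
    rcases m.exists_end hi with ⟨j, rfl⟩ | ⟨j, rfl⟩
    · rw [swap_fst, swap_second]
    · rw [swap_second, swap_fst]
  · push Not at h
    rw [m.swap_other p h, m.swap_other p h]

lemma jump_ends (g : Option D.V) (i : Fin 3) :
    jump R g (m.endB i) = -jump R g (m.endA (i + 1)) := by
  have h := jump_closed (R := R) g (m.c (i + 1))
  rw [endB, endA]
  cases m.β (i + 1)
  · rw [Bool.not_false]; linear_combination h
  · rw [Bool.not_true]; linear_combination h

variable (R) in
/-- The coefficients of the cycle of `D'` at `g`, on the edges of `D`: the coefficient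
at `p` is that of the edge of `D'` that leaves the passage which the move puts into the place of
`p`. -/
def pulled (g : Option D.V) (p : D.V × Bool) : R :=
  D'.cycle R (g.map m.e) (Prod.map m.e id (m.swap p))

lemma cycle_eq_pulled (g : Option D.V) (q : D.V × Bool) :
    D'.cycle R (g.map m.e) (Prod.map m.e id q) = m.pulled R g (m.swap q) := by
  rw [pulled, swap_swap]

lemma cycle_prev_eq_pulled (g : Option D.V) (q : D.V × Bool) :
    D'.cycle R (g.map m.e) (D'.next.symm (Prod.map m.e id q)) =
      m.pulled R g (D.next.symm (m.swap q)) := by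
  have h := m.next_eq (D.next.symm (m.swap q))
  rw [Equiv.apply_symm_apply, swap_swap] at h
  rw [pulled, ← h, Equiv.symm_apply_apply]

lemma pulled_jump (g : Option D.V) (p : D.V × Bool) :
    m.pulled R g p - m.pulled R g (D.next.symm p) = jump R g (m.swap p) := by
  have h := m.cycle_prev_eq_pulled (R := R) g (m.swap p)
  rw [swap_swap] at h
  rw [← h, pulled, cycle_jump, jump_map m.e.injective]

/-- The move changes the cycle at `g` only on the edges between two corners: there the jumps at
the two ends of the side occur in the opposite order. -/
lemma pulled_eq [DecidableEq D.V] (g : Option D.V) (p : D.V × Bool) : m.pulled R g p =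
    D.cycle R g p + ∑ i, (jump R g (m.second i) - jump R g (m.first i)) *
      (Pi.single (m.first i) 1 : _ → R) p := by
  cases g with
  | none => simp [pulled, cycle, jump]
  | some v =>
    set J := jump R (some v) with hJ
    -- The chain `z` has the required jumps, so that it suffices to compare one value. This is
    -- done at the passage that the move replaces by `(v, true)`, where the left half begins.
    set z : D.V × Bool → R := fun p => D.cycle R (some v) p +
      ∑ i, (J (m.second i) - J (m.first i)) * (Pi.single (m.first i) 1 : _ → R) p with hz
    have hz1 : ∀ i, z (m.first i) =
        D.cycle R (some v) (m.first i) + J (m.second i) - J (m.first i) := by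
      intro i
      simp only [hz]
      rw [Finset.sum_eq_single i]
      · rw [Pi.single_eq_same]; ring
      · intro j _ hj
        rw [Pi.single_eq_of_ne (fun h => hj (m.first_inj h).symm), mul_zero]
      · simp
    have hz2 : ∀ p, (∀ i, p ≠ m.first i) → z p = D.cycle R (some v) p := by
      intro p hp
      simp only [hz]
      rw [Finset.sum_eq_zero fun i _ => by rw [Pi.single_eq_of_ne (hp i), mul_zero], add_zero]
    have hcj := fun i => D.cycle_jump (R := R) (some v) (m.second i)
    simp only [prev_second] at hcj
    have h0 : ∀ i, ((m.first i).1 = v → J (m.second i) = 0) ∧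
        ((m.second i).1 = v → J (m.first i) = 0) :=
      fun i => ⟨fun h => jump_of_ne fun h' => m.first_fst_ne i (h.trans h'.symm),
        fun h => jump_of_ne fun h' => m.first_fst_ne i (h'.trans h.symm)⟩
    refine congrFun (D.eq_of_jump (x := m.pulled R (some v)) (y := z) (fun p => ?_)
      (m.swap (v, true)) ?_) p
    · rw [pulled_jump]
      by_cases h : ∃ i, p.1 = m.c i
      · obtain ⟨i, hi⟩ := h
        rcases m.exists_end hi with ⟨j, rfl⟩ | ⟨j, rfl⟩
        · rw [hz1, hz2 _ (fun i => m.prev_first_ne j i), swap_fst, ← hJ]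
          linear_combination -D.cycle_jump (R := R) (some v) (m.first j)
        · rw [prev_second, hz1, hz2 _ (fun i => m.second_ne_first j i), swap_second, ← hJ]
          linear_combination -hcj j
      · push Not at h
        rw [m.swap_other p h, hz2 p, hz2, cycle_jump]
        · intro i hi
          rcases p with ⟨w, e⟩
          have h2 : (w, e) = m.second i := by rw [← next_first, ← hi, Equiv.apply_symm_apply]
          obtain ⟨k, hk⟩ := m.exists_second_fst i
          exact h k (by rw [h2, hk])
        · intro i hi
          obtain ⟨k, hk⟩ := m.exists_first_fst i
          exact h k (by rw [hi, hk])
    · rw [← cycle_eq_pulled]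
      have h1 : D'.cycle R ((some v).map m.e) (Prod.map m.e id (v, true)) = 1 := D'.cycle_true _
      have h2 : D.cycle R (some v) (v, true) = 1 := D.cycle_true _
      rw [h1]
      by_cases h : ∃ i, v = m.c i
      · obtain ⟨i, hi⟩ := h
        rcases m.exists_end (p := (v, true)) hi with ⟨j, hj⟩ | ⟨j, hj⟩
        · rw [hj, swap_fst, hz2 _ (fun i => m.second_ne_first j i)]
          rw [hj] at h2
          have := (h0 j).1 (by rw [← hj])
          linear_combination -hcj j - h2 - this
        · rw [hj, swap_second, hz1]
          rw [hj] at h2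
          have := (h0 j).2 (by rw [← hj])
          linear_combination hcj j - h2 + this
      · push Not at h
        rw [m.swap_other _ h, hz2, h2]
        intro i hi
        obtain ⟨k, hk⟩ := m.exists_first_fst i
        exact h k (by rw [← hk, ← hi])

lemma pulled_of_ne (g : Option D.V) {p : D.V × Bool} (hp : ∀ i, p ≠ m.first i) :
    m.pulled R g p = D.cycle R g p := by
  classical
  rw [pulled_eq, Finset.sum_eq_zero fun i _ => by rw [Pi.single_eq_of_ne (hp i), mul_zero],
    add_zero]

lemma pulled_first (g : Option D.V) (i : Fin 3) : m.pulled R g (m.first i) =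
    D.cycle R g (D.next.symm (m.first i)) + jump R g (m.second i) := by
  classical
  rw [pulled_eq, Finset.sum_eq_single i]
  · rw [Pi.single_eq_same]
    linear_combination D.cycle_jump (R := R) g (m.first i)
  · intro j _ hj
    rw [Pi.single_eq_of_ne (fun h => hj (m.first_inj h).symm), mul_zero]
  · simp

/-- All coefficients of a cycle before and after the move, on the edges at the triangle, in terms of
the coefficients `X i` on the edges that enter the sides and of the jumps `j i` at `endA i`. -/
lemma exists_values (g : Option D.V) : ∃ X j : Fin 3 → R, ∀ i,
    D.cycle R g (m.endA i) = (if m.t i then X i + j i else X i + j i - j (i + 1)) ∧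
    D.cycle R g (m.endB i) = (if m.t i then X i + j i - j (i + 1) else X i - j (i + 1)) ∧
    D.cycle R g (D.next.symm (m.endA i)) = (if m.t i then X i else X i - j (i + 1)) ∧
    D.cycle R g (D.next.symm (m.endB i)) = (if m.t i then X i + j i else X i) ∧
    m.pulled R g (m.endA i) = (if m.t i then X i - j (i + 1) else X i + j i - j (i + 1)) ∧
    m.pulled R g (m.endB i) = (if m.t i then X i + j i - j (i + 1) else X i + j i) ∧
    m.pulled R g (D.next.symm (m.endA i)) = (if m.t i then X i else X i + j i) ∧
    m.pulled R g (D.next.symm (m.endB i)) = (if m.t i then X i - j (i + 1) else X i) := by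
  refine ⟨fun i => D.cycle R g (D.next.symm (m.first i)), fun i => jump R g (m.endA i), fun i => ?_⟩
  have h1 := D.cycle_jump (R := R) g (m.first i)
  have h2 := D.cycle_jump (R := R) g (m.second i)
  have h3 := m.pulled_first (R := R) g i
  have h4 := m.pulled_of_ne (R := R) g (p := m.second i) fun j => m.second_ne_first i j
  have h5 := m.pulled_of_ne (R := R) g (p := D.next.symm (m.first i)) fun j => m.prev_first_ne i j
  have h6 := m.prev_second i
  have h7 := m.jump_ends (R := R) g i
  cases ht : m.t i
  · have hf : m.first i = m.endB i := by simp [first, ht]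
    have hs : m.second i = m.endA i := by simp [second, ht]
    rw [hs] at h2 h3 h4 h6
    rw [hf] at h1 h3 h5 h6
    simp only [hf, h6] at h2 ⊢
    simp only [Bool.false_eq_true, if_false]
    refine ⟨?_, ?_, ?_, trivial, ?_, ?_, ?_, ?_⟩ <;> grind
  · have hf : m.first i = m.endA i := by simp [first, ht]
    have hs : m.second i = m.endB i := by simp [second, ht]
    rw [hs] at h2 h3 h4 h6
    rw [hf] at h1 h3 h5 h6
    simp only [hf, h6] at h2 ⊢
    simp only [if_true]
    refine ⟨?_, ?_, trivial, ?_, ?_, ?_, ?_, ?_⟩ <;> grind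

/-- A third Reidemeister move does not change intersection numbers. -/
lemma b_map (g h : Option D.V) :
    (D'.basedMatrix R).b (g.map m.e) (h.map m.e) = (D.basedMatrix R).b g h := by
  classical
  rw [basedMatrix_b, basedMatrix_b, inter, inter, ← m.e.sum_comp]
  have key1 := fun g v e => m.cycle_prev_eq_pulled (R := R) g (v, e)
  have key2 := fun g v e => m.cycle_eq_pulled (R := R) g (v, e)
  simp only [Prod.map_apply, id] at key1 key2
  simp only [key1, key2]
  rw [← Finset.sum_add_sum_compl (Finset.univ.map ⟨m.c, m.c_inj⟩),
    ← Finset.sum_add_sum_compl (Finset.univ.map ⟨m.c, m.c_inj⟩) fun v => D.cycle R g _ * _ - _]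
  congr 1
  · obtain ⟨X, j, hX⟩ := m.exists_values (R := R) g
    obtain ⟨Y, k, hY⟩ := m.exists_values (R := R) h
    have hA : ∀ i, m.endA i = (m.c i, !(m.β i)) := fun i => rfl
    have hB : ∀ i, m.endB (i - 1) = (m.c i, m.β i) := m.endB_pred
    have e1 : ∀ i, (if m.β i then
        m.pulled R g (D.next.symm (m.endB i)) * m.pulled R h (D.next.symm (m.endA (i - 1))) -
          m.pulled R g (m.endA (i - 1)) * m.pulled R h (m.endB i)
      else m.pulled R g (D.next.symm (m.endA (i - 1))) * m.pulled R h (D.next.symm (m.endB i)) -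
          m.pulled R g (m.endB i) * m.pulled R h (m.endA (i - 1))) =
      m.pulled R g (D.next.symm (m.swap (m.c i, false))) *
          m.pulled R h (D.next.symm (m.swap (m.c i, true))) -
        m.pulled R g (m.swap (m.c i, true)) * m.pulled R h (m.swap (m.c i, false)) := by
      intro i
      rw [← m.swap_endA i, ← m.swap_endB (i - 1), hA, hB]
      cases m.β i <;> simp
    have e2 : ∀ i, (if m.β i then
        D.cycle R g (D.next.symm (m.endA i)) * D.cycle R h (D.next.symm (m.endB (i - 1))) -
          D.cycle R g (m.endB (i - 1)) * D.cycle R h (m.endA i)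
      else D.cycle R g (D.next.symm (m.endB (i - 1))) * D.cycle R h (D.next.symm (m.endA i)) -
          D.cycle R g (m.endA i) * D.cycle R h (m.endB (i - 1))) =
      D.cycle R g (D.next.symm (m.c i, false)) * D.cycle R h (D.next.symm (m.c i, true)) -
        D.cycle R g (m.c i, true) * D.cycle R h (m.c i, false) := by
      intro i
      rw [hA, hB]
      cases m.β i <;> simp
    rw [Finset.sum_map, Finset.sum_map]
    simp only [Function.Embedding.coeFn_mk, ← e1, ← e2]
    simp only [hX, hY, m.β_eq, Fin.sum_univ_three]
    rw [show (0 - 1 : Fin 3) = 2 from rfl, show (1 - 1 : Fin 3) = 0 from rfl,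
      show (2 - 1 : Fin 3) = 1 from rfl, show (0 + 1 : Fin 3) = 1 from rfl,
      show (1 + 1 : Fin 3) = 2 from rfl, show (2 + 1 : Fin 3) = 0 from rfl]
    -- the orientations of the sides give eight polynomial identities in `X`, `Y`, `j`, `k`
    cases m.t 0 <;> cases m.t 1 <;> cases m.t 2 <;> simp <;> ring
  · refine Finset.sum_congr rfl fun v hv => ?_
    have hv' : ∀ i, v ≠ m.c i := fun i h => by simp [h] at hv
    have h1 : ∀ e i, (v, e) ≠ m.first i := fun e i h => by
      obtain ⟨k, hk⟩ := m.exists_first_fst i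
      exact hv' k (by rw [← hk, ← h])
    have h2 : ∀ e i, D.next.symm (v, e) ≠ m.first i := fun e i h => by
      obtain ⟨k, hk⟩ := m.exists_second_fst i
      exact hv' k (by rw [← hk, ← next_first, ← h, Equiv.apply_symm_apply])
    rw [m.swap_other _ hv', m.swap_other _ hv', m.pulled_of_ne _ (h1 _), m.pulled_of_ne _ (h1 _),
      m.pulled_of_ne _ (h2 _), m.pulled_of_ne _ (h2 _)]

/-- A third Reidemeister move induces an isomorphism of based matrices. -/
lemma isExt : BasedMatrix.IsExt (D.basedMatrix R) (D'.basedMatrix R) (Option.map m.e) :=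
  ⟨⟨Option.map_injective m.e.injective, rfl, m.b_map⟩,
    Or.inl ((compl_range_map m.e).trans (by simp; rfl))⟩

variable (R) in
open Classical in
/-- The boundary of the triangle, with the counterclockwise orientation. -/
def boundary : D.V × Bool → R :=
  ∑ i, (if m.t i then (1 : ℤ) else -1) • (Pi.single (m.first i) 1 : _ → R)

lemma inter_boundary (h : Option D.V) : D.inter (m.boundary R) (D.cycle R h) = 0 := by
  classical
  obtain ⟨X, j, hX⟩ := m.exists_values (R := R) h
  have hA : ∀ i, m.endA i = (m.c i, !(m.β i)) := fun i => rfl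
  have hB : ∀ i, m.endB (i - 1) = (m.c i, m.β i) := m.endB_pred
  have hB' : ∀ i, m.endB i = (m.c (i + 1), m.β (i + 1)) := fun i => rfl
  have key : ∀ i, D.inter ((if m.t i then (1 : ℤ) else -1) • (Pi.single (m.first i) 1 : _ → R))
      (D.cycle R h) = if m.t i then
        (if m.β (i + 1) then 0 else D.cycle R h (D.next.symm (m.endA (i + 1)))) -
          (if m.β i then 0 else D.cycle R h (m.endB (i - 1)))
      else -((if m.β i then D.cycle R h (D.next.symm (m.endB (i - 1))) else 0) -
          (if m.β (i + 1) then D.cycle R h (m.endA (i + 1)) else 0)) := by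
    intro i
    rw [inter_smul, inter_single, next_first]
    cases ht : m.t i
    · simp only [first, second, ht, Bool.false_eq_true, if_false]
      rw [hB, hA, hA, hB']
      cases m.β i <;> cases m.β (i + 1) <;> simp
    · simp only [first, second, ht, if_true]
      rw [hB, hA, hA, hB']
      cases m.β i <;> cases m.β (i + 1) <;> simp
  rw [boundary, inter_sum]
  simp only [key, hX, m.β_eq, Fin.sum_univ_three, add_sub_cancel_right, sub_add_cancel]
  rw [show (0 - 1 : Fin 3) = 2 from rfl, show (1 - 1 : Fin 3) = 0 from rfl,
    show (2 - 1 : Fin 3) = 1 from rfl, show (0 + 1 : Fin 3) = 1 from rfl,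
    show (1 + 1 : Fin 3) = 2 from rfl, show (2 + 1 : Fin 3) = 0 from rfl]
  cases m.t 0 <;> cases m.t 1 <;> cases m.t 2 <;> simp <;> ring

/-- The left halves at the corners, with the incidence signs, add up to the boundary of the triangle
and to a multiple of the whole diagram. -/
lemma exists_sum_cycle : ∃ k : ℤ, ∑ i, m.sign i • D.cycle R (some (m.c i)) =
    k • D.cycle R none + m.boundary R := by
  classical
  -- All coefficients are images of integers, so that the constant difference of the two sides
  -- is an integer multiple of the whole diagram.
  have hint : ∀ q, ∃ k : ℤ, (∑ i, m.sign i • D.cycle R (some (m.c i)) - m.boundary R) q = k := by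
    intro q
    have h1 : ∀ c, ∃ k : ℤ, D.cycle R (some c) q = k := fun c => by
      by_cases hq : q ∈ D.leftHalf c
      · exact ⟨1, by simp [cycle, hq]⟩
      · exact ⟨0, by simp [cycle, hq]⟩
    have h2 : ∀ i, ∃ k : ℤ, (Pi.single (m.first i) 1 : _ → R) q = k := fun i => by
      by_cases hq : q = m.first i
      · exact ⟨1, by simp [hq]⟩
      · exact ⟨0, by simp [Pi.single_eq_of_ne hq]⟩
    choose a ha using h1
    choose b hb using h2
    refine ⟨∑ i, m.sign i * a (m.c i) - ∑ i, (if m.t i then (1 : ℤ) else -1) * b i, ?_⟩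
    simp only [boundary, Pi.sub_apply, Finset.sum_apply, Pi.smul_apply, ha, hb]
    simp only [zsmul_eq_mul]
    push_cast
    rfl
  obtain ⟨k, hk⟩ := hint (m.c 0, true)
  refine ⟨k, D.eq_of_jump (fun p => ?_) (m.c 0, true) ?_⟩
  · -- both sides jump by `1` at the ends `endA i` and by `-1` at the ends `endB i`
    have h1 : ∀ i, m.sign i • jump R (some (m.c i)) p =
        (Pi.single (m.endA i) 1 : _ → R) p - (Pi.single (m.endB (i - 1)) 1 : _ → R) p := by
      intro i
      rw [endB_pred, endA, m.β_eq, sign, jump]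
      cases m.t (i - 1) <;> cases m.t i <;> simp
    have h2 : ∀ i, (if m.t i then (1 : ℤ) else -1) • ((Pi.single (m.first i) 1 : _ → R) p -
        (Pi.single (m.second i) 1 : _ → R) p) =
        (Pi.single (m.endA i) 1 : _ → R) p - (Pi.single (m.endB i) 1 : _ → R) p := by
      intro i
      rw [first, second]
      split_ifs <;> simp
    have h3 : ∑ i, (Pi.single (m.endB (i - 1)) 1 : _ → R) p =
        ∑ i, (Pi.single (m.endB i) 1 : _ → R) p :=
      (Equiv.subRight (1 : Fin 3)).sum_comp fun i => (Pi.single (m.endB i) 1 : _ → R) p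
    have h4 : D.cycle R none (D.next.symm p) = D.cycle R none p := rfl
    simp only [boundary, Pi.add_apply, Finset.sum_apply, Pi.smul_apply, h4, add_sub_add_left_eq_sub]
    rw [← Finset.sum_sub_distrib, ← Finset.sum_sub_distrib]
    simp only [← smul_sub, cycle_jump, h1, single_prev, next_first, h2, Finset.sum_sub_distrib, h3]
  · have : D.cycle R none (m.c 0, true) = 1 := rfl
    rw [Pi.sub_apply] at hk
    rw [Pi.add_apply, Pi.smul_apply, this, zsmul_one, ← hk, sub_add_cancel]

/-- The signed sum of the rows of the three corners is an integer multiple of the row of `s`. -/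
lemma exists_relation : ∃ k : ℤ, ∀ h : (D.basedMatrix R).G,
    ∑ i, m.sign i • (D.basedMatrix R).b (some (m.c i)) h =
      k • (D.basedMatrix R).b (D.basedMatrix R).s h := by
  obtain ⟨k, hk⟩ := m.exists_sum_cycle (R := R)
  refine ⟨k, fun (h : Option D.V) => ?_⟩
  change ∑ i, m.sign i • D.inter (D.cycle R (some (m.c i))) (D.cycle R h) =
    k • D.inter (D.cycle R none) (D.cycle R h)
  rw [← inter_smul, ← add_zero (D.inter (k • _) _), ← m.inter_boundary h, ← inter_add, ← hk,
    inter_sum]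
  exact Finset.sum_congr rfl fun i _ => (D.inter_smul _ _ _).symm

end MoveR3

end Diagram

variable {κ : KnotKind} {R : Type*} [CommRing R]

/-! ### The parity of a knot -/

lemma Diagram.Step.homologous {D D' : Diagram κ} (h : Diagram.Step D D') :
    (D.basedMatrix R).Homologous (D'.basedMatrix R) := by
  rcases h with ⟨⟨m⟩⟩ | ⟨⟨m⟩⟩ | ⟨⟨m⟩⟩ | ⟨⟨m⟩⟩
  exacts [m.isExt.homologous, m.isExt.homologous, m.isExt.homologous, m.isExt.homologous]

/-- The based matrices of two diagrams of a knot are homologous. -/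
theorem Diagram.IsDiagramOf.homologous {K : Knot κ} {D D' : Diagram κ} (hD : D.IsDiagramOf K)
    (hD' : D'.IsDiagramOf K) : (D.basedMatrix R).Homologous (D'.basedMatrix R) := by
  have h := Quot.eqvGen_exact (Eq.trans hD (Eq.symm hD'))
  clear hD hD'
  induction h with
  | rel D D' h => exact h.homologous
  | refl D => exact .refl _
  | symm D D' _ ih => exact ih.symm
  | trans D D₁ D' _ _ ih ih' => exact ih.trans ih'

lemma IsPrimitiveMatrixOf.homologous {K : Knot κ} {T : BasedMatrix R} (h : IsPrimitiveMatrixOf K T)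
    {D : Diagram κ} (hD : D.IsDiagramOf K) : (D.basedMatrix R).Homologous T := by
  obtain ⟨D', hD', h'⟩ := h.2
  exact (hD.homologous hD').trans h'

lemma exists_isPrimitiveMatrixOf (K : Knot κ) : ∃ T : BasedMatrix R, IsPrimitiveMatrixOf K T := by
  obtain ⟨D, hD⟩ := Quot.exists_rep K
  obtain ⟨T, hT, h⟩ := (D.basedMatrix R).exists_isPrimitive_homologous
  exact ⟨T, hT, D, hD, h⟩

lemma IsPrimitiveMatrixOf.nonempty_iso {K : Knot κ} {T T' : BasedMatrix R}
    (h : IsPrimitiveMatrixOf K T) (h' : IsPrimitiveMatrixOf K T') :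
    Nonempty (BasedMatrix.Iso T T') := by
  obtain ⟨D, hD⟩ := Quot.exists_rep K
  exact ((h.homologous hD).symm.trans (h'.homologous hD)).nonempty_iso h.1 h'.1

lemma IsPrimitiveMatrixOf.nonempty_chainSystem {K : Knot κ} {T : BasedMatrix R}
    (h : IsPrimitiveMatrixOf K T) : Nonempty (ChainSystem K T) :=
  ⟨fun _ hD => Classical.choice (h.homologous hD)⟩

lemma isPreParity_reducedStableParity {K : Knot κ} {T : BasedMatrix R} (hp : T.IsPrimitive)
    (F : ChainSystem K T) : IsPreParity K (reducedStableParity F) where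
  isotopy _ _ _ _ m v := m.isExt.reducedParity_eq _ _ hp (some v)
  r1 _ _ _ _ m v := m.isExt.reducedParity_eq _ _ hp (some v)
  r2 _ _ _ _ m v := m.isExt.reducedParity_eq _ _ hp (some v)
  r3 _ _ _ _ m v := m.isExt.reducedParity_eq _ _ hp (some v)
  r1_sum D D' hD' m := by
    have key : ∀ k : ℤ, (∀ h, (D'.basedMatrix R).b (some m.c) h =
        k • (D'.basedMatrix R).b (D'.basedMatrix R).s h) →
          reducedStableParity F D' hD' m.c = 0 := by
      intro k hk
      have := (F D' hD').reducedParity_relation D'.basedMatrix_b_s Finset.univ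
        (fun _ : Unit => 1) (fun _ => some m.c) k (by simpa using hk)
      rw [Fintype.sum_unique, one_smul] at this
      exact this
    rcases m.annihilating_or_core (R := R) with h | h
    · exact key 0 fun x => by rw [zero_smul]; exact h.2 x
    · exact key 1 fun x => by rw [one_smul]; exact h.2 x
  r2_sum D D' hD' m := by
    have := (F D' hD').reducedParity_relation D'.basedMatrix_b_s Finset.univ
      (fun _ : Fin 2 => 1) ![some m.c, some m.c'] 1
      (fun x => by
        rw [Fin.sum_univ_two, one_smul, one_smul, one_smul]
        exact m.complementary.2.2.2 x)
    rw [Fin.sum_univ_two, one_smul, one_smul] at this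
    exact this

lemma isOrientedParity_reducedStableParity {K : Knot κ} {T : BasedMatrix R} (hp : T.IsPrimitive)
    (F : ChainSystem K T) : IsOrientedParity K (reducedStableParity F) where
  toIsPreParity := isPreParity_reducedStableParity hp F
  r3_sum D D' hD m := by
    obtain ⟨k, hk⟩ := m.exists_relation (R := R)
    exact (F D hD).reducedParity_relation D.basedMatrix_b_s Finset.univ m.sign
      (fun i => some (m.c i)) k hk

lemma isParity_reducedStableParity {K : Knot κ} {T : BasedMatrix R} (hp : T.IsPrimitive)
    (F : ChainSystem K T) (h2 : (2 : R) = 0) : IsParity K (reducedStableParity F) where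
  toIsPreParity := isPreParity_reducedStableParity hp F
  r3_sum D D' hD m := by
    rw [← (isOrientedParity_reducedStableParity hp F).r3_sum D D' hD m]
    refine Finset.sum_congr rfl fun i _ => ?_
    rw [Diagram.MoveR3.sign]
    split_ifs
    · rw [one_smul]
    · rw [neg_one_smul, BasedMatrix.CoeffGroup.neg_eq h2]

/-! ### A parity that is not Gaussian -/

/-- If all tribes are singletons, even after an annihilating element has been adjoined, then every
fixed point of the automorphisms is a class that indexes the coefficient group. -/
lemma BasedMatrix.singleton_isBarClass {T : BasedMatrix R} {z : T.G}
    (hT : T.adjoinAnnihilating.stable = ⊥) (hz : ∀ φ : Iso T T, φ.toEquiv z = z) :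
    {z} ∈ T.barPartition.classes ∧ Disjoint {z} T.zeroTribe := by
  have hst : ∀ x y, T.stable x y → x = y := fun x y hxy => by
    rw [← T.isExt_adjoin.stable_iff, hT] at hxy
    exact Option.some_injective _ hxy
  refine ⟨⟨z, ?_⟩, ?_⟩
  · ext x
    rw [Set.mem_singleton_iff, Set.mem_ofPred_eq]
    constructor
    · rintro rfl; exact Setoid.refl' _ _
    · intro hx
      have h : (x = z) = (z = z) := hx (Setoid.ker fun w : T.G => w = z)
        ⟨fun a b hab => by rw [hst a b hab], fun φ a => propext
          ⟨fun h => by rw [h, hz], fun h => φ.toEquiv.injective (h.trans (hz φ).symm)⟩⟩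
      exact h.mpr rfl
  · rw [Set.disjoint_singleton_left]
    intro h
    have h' : T.adjoinAnnihilating.stable (some z) none := h
    rw [hT] at h'
    exact Option.some_ne_none z h'

/-- A set that begins at `(c, true)`, ends before `(c, false)` and is closed under the passage along
the knot otherwise is the left half at `c`. -/
lemma Diagram.leftHalf_eq (D : Diagram κ) {c : D.V} {S : Set (D.V × Bool)}
    (h1 : (c, true) ∈ S) (h2 : (c, false) ∉ S) (h3 : D.next.symm (c, true) ∉ S)
    (h4 : D.next.symm (c, false) ∈ S) (h5 : ∀ p, p.1 ≠ c → (p ∈ S ↔ D.next.symm p ∈ S)) :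
    D.leftHalf c = S := by
  classical
  have h := D.cycle_eq (R := ℤ) (c := c) (x := S.indicator 1) (fun p => by
    by_cases h : p.1 = c
    · obtain ⟨v, e⟩ := p
      obtain rfl : v = c := h
      cases e <;> simp [jump, h1, h2, h3, h4]
    · rw [jump_of_ne h]
      simp [Set.indicator, h5 p h]) (by simp [h1])
  ext p
  have hp := congrFun h p
  by_cases h6 : p ∈ S <;> by_cases h7 : p ∈ D.leftHalf c <;> simp_all [cycle]

/-- The successor function of the diagram with the Gauss code `0 1 0 2 1 2`. -/
def exampleNext : Fin 3 × Bool → Fin 3 × Bool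
  | (0, false) => (1, false)
  | (1, false) => (0, true)
  | (0, true) => (2, true)
  | (2, true) => (1, true)
  | (1, true) => (2, false)
  | (2, false) => (0, false)

/-- The inverse of `exampleNext`. -/
def examplePrev : Fin 3 × Bool → Fin 3 × Bool
  | (1, false) => (0, false)
  | (0, true) => (1, false)
  | (2, true) => (0, true)
  | (1, true) => (2, true)
  | (2, false) => (1, true)
  | (0, false) => (2, false)

/-- A virtual knot diagram with three crossings. The crossing `1` is even, the crossings `0` and `2`
are odd, and the left half at `1` meets that at `2` but not that at `0`. -/
def exampleDiagram : Diagram .virtual where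
  V := Fin 3
  next := ⟨exampleNext, examplePrev, by unfold Function.LeftInverse; decide,
    by unfold Function.RightInverse Function.LeftInverse; decide⟩
  cyclic p q := by
    have h : ∀ p q, ∃ k : Fin 6, exampleNext^[k] p = q := by decide
    obtain ⟨k, hk⟩ := h p q
    exact ⟨k, hk⟩
  info _ := true

/-- The left halves of `exampleDiagram`. -/
def exampleHalf : Fin 3 → Finset (Fin 3 × Bool) :=
  ![{(0, true), (2, true), (1, true), (2, false)}, {(1, true), (2, false), (0, false)},
    {(2, true), (1, true)}]

lemma exampleDiagram_leftHalf (c : Fin 3) :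
    exampleDiagram.leftHalf c = (exampleHalf c : Set (Fin 3 × Bool)) := by
  have h : ∀ c : Fin 3, (c, true) ∈ exampleHalf c ∧ (c, false) ∉ exampleHalf c ∧
      examplePrev (c, true) ∉ exampleHalf c ∧ examplePrev (c, false) ∈ exampleHalf c ∧
      ∀ p : Fin 3 × Bool, p.1 ≠ c → (p ∈ exampleHalf c ↔ examplePrev p ∈ exampleHalf c) := by
    decide
  obtain ⟨h1, h2, h3, h4, h5⟩ := h c
  exact exampleDiagram.leftHalf_eq (c := c) h1 h2 h3 h4 h5

/-- The based matrix of `exampleDiagram` modulo `2`: the adjacency matrix of the path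
`0 - s - 2 - 1`. -/
def exampleB : Option (Fin 3) → Option (Fin 3) → ZMod 2
  | none, some 0 | some 0, none | none, some 2 | some 2, none | some 1, some 2 | some 2, some 1 => 1
  | _, _ => 0

lemma exampleDiagram_b (g h : Option (Fin 3)) :
    (exampleDiagram.basedMatrix (ZMod 2)).b g h = exampleB g h := by
  let cyc : Option (Fin 3) → Fin 3 × Bool → ZMod 2 := fun g p =>
    g.elim 1 fun c => if p ∈ exampleHalf c then 1 else 0
  have hc : ∀ g : Option (Fin 3), exampleDiagram.cycle (ZMod 2) g = cyc g := by
    rintro (_ | c)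
    · rfl
    · funext p
      by_cases hp : p ∈ exampleHalf c
      · have hp' : p ∈ exampleDiagram.leftHalf c := by rw [exampleDiagram_leftHalf]; exact hp
        exact (Set.indicator_of_mem hp' _).trans (if_pos hp).symm
      · have hp' : p ∉ exampleDiagram.leftHalf c := by rw [exampleDiagram_leftHalf]; exact hp
        exact (Set.indicator_of_notMem hp' _).trans (if_neg hp).symm
  have key : ∀ g h : Option (Fin 3), ∑ v : Fin 3, (cyc g (examplePrev (v, false)) *
      cyc h (examplePrev (v, true)) - cyc g (v, true) * cyc h (v, false)) = exampleB g h := by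
    decide
  rw [← key g h, ← hc g, ← hc h]
  rfl

lemma exampleDiagram_isPrimitive : (exampleDiagram.basedMatrix (ZMod 2)).IsPrimitive := by
  refine ⟨fun (g : Option (Fin 3)) hg => ?_, fun (g : Option (Fin 3)) hg => ?_,
    fun (g g' : Option (Fin 3)) hg => ?_⟩
  · have h : ∀ g, g ≠ none → ¬ ∀ h, exampleB g h = 0 := by decide
    exact h g hg.1 fun h => by rw [← exampleDiagram_b]; exact hg.2 h
  · have h : ∀ g, g ≠ none → ¬ ∀ h, exampleB g h = exampleB none h := by decide
    exact h g hg.1 fun h => by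
      rw [← exampleDiagram_b, ← exampleDiagram_b]; exact hg.2 h
  · have h : ∀ g g', g ≠ none → g' ≠ none →
        ¬ ∀ h, exampleB g h + exampleB g' h = exampleB none h := by decide
    exact h g g' hg.1 hg.2.1 fun h => by
      rw [← exampleDiagram_b, ← exampleDiagram_b, ← exampleDiagram_b]; exact hg.2.2.2 h

/-- The matrix `exampleB` with one more element, `none`, that is annihilating. -/
def exampleB' (g h : Option (Option (Fin 3))) : ZMod 2 :=
  g.elim 0 fun g => h.elim 0 fun h => exampleB g h

/-- After an annihilating element has been adjoined to the based matrix of `exampleDiagram`, the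
rows are still distinct modulo the row of `s`, so that all tribes are singletons. -/
lemma exampleDiagram_stable :
    (exampleDiagram.basedMatrix (ZMod 2)).adjoinAnnihilating.stable = ⊥ := by
  set T := (exampleDiagram.basedMatrix (ZMod 2)).adjoinAnnihilating with hT
  have hB : ∀ g h : Option (Option (Fin 3)), T.b g h = exampleB' g h := by
    rintro (_ | g) (_ | h)
    · rfl
    · rfl
    · rfl
    · exact exampleDiagram_b g h
  have key : ∀ (k : ZMod 2) (x y : Option (Option (Fin 3))),
      (∀ c, exampleB' x c + exampleB' y c = k * exampleB' (some none) c) →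
        x = some none ∨ y = some none ∨ x = y := by
    decide
  refine le_bot_iff.1 (BasedMatrix.stable_le_of_derived_le fun x y h => ?_)
  rw [BasedMatrix.derived_iff] at h
  change x = y
  rcases h with ⟨rfl, rfl⟩ | ⟨hx, hy, ε, k, hε, h⟩
  · rfl
  · refine ((key k x y fun (c : T.G) => ?_).resolve_left hx).resolve_left hy
    have hc : {w | (⊥ : Setoid T.G) c w} = {c} := by ext w; exact eq_comm
    have h := h c
    rw [hc, BasedMatrix.rowSum_singleton, BasedMatrix.rowSum_singleton,
      BasedMatrix.rowSum_singleton, zsmul_eq_mul, zsmul_eq_mul] at h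
    have hε' : (ε : ZMod 2) = 1 := by
      rcases hε with rfl | rfl
      · simp
      · decide
    rw [hε', one_mul] at h
    exact ((congrArg₂ (· + ·) (hB x c) (hB y c)).symm.trans h).trans
      (congrArg (_ * ·) (hB (some none) c))

/-- The crossing `1` as an element of the based matrix. -/
def exampleZ : (exampleDiagram.basedMatrix (ZMod 2)).G := (some 1 : Option (Fin 3))

lemma exampleDiagram_iso (φ : BasedMatrix.Iso (exampleDiagram.basedMatrix (ZMod 2))
    (exampleDiagram.basedMatrix (ZMod 2))) : φ.toEquiv exampleZ = exampleZ := by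
  have h : ∀ g : Option (Fin 3), g ≠ none → exampleB g none = 0 → g = some 1 := by decide
  refine h (φ.toEquiv exampleZ) (fun h' => ?_) ?_
  · exact Option.some_ne_none _ (φ.toEquiv.injective (h'.trans φ.map_s.symm))
  · refine (exampleDiagram_b _ _).symm.trans ?_
    have h1 := φ.map_b exampleZ none
    rw [show φ.toEquiv none = none from φ.map_s] at h1
    exact h1.trans ((exampleDiagram_b _ _).trans (by decide))

/-- The crossing `1` forms a class of its own, since it is the only even crossing. -/
def exampleClass : (exampleDiagram.basedMatrix (ZMod 2)).BarClass :=
  ⟨{exampleZ}, BasedMatrix.singleton_isBarClass exampleDiagram_stable exampleDiagram_iso⟩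

lemma exampleClass_val : exampleClass.1 = {exampleZ} := rfl

theorem exists_not_gaussian : ∃ (K : Knot .virtual) (T : BasedMatrix (ZMod 2))
      (F : ChainSystem K T) (D : Diagram .virtual) (hD : D.IsDiagramOf K)
      (c c' : D.V), IsPrimitiveMatrixOf K T ∧
        D.gaussianParity c = D.gaussianParity c' ∧
        reducedStableParity F D hD c ≠ reducedStableParity F D hD c' := by
  have hprim : IsPrimitiveMatrixOf (Quot.mk _ exampleDiagram)
      (exampleDiagram.basedMatrix (ZMod 2)) :=
    ⟨exampleDiagram_isPrimitive, exampleDiagram, rfl, .refl _⟩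
  obtain ⟨F⟩ := hprim.nonempty_chainSystem
  refine ⟨_, _, F, exampleDiagram, rfl, (0 : Fin 3), (2 : Fin 3), hprim, ?_, ?_⟩
  · have h : ∀ c : Fin 3, exampleDiagram.gaussianParity c =
        (((exampleHalf c).card - 1 : ℕ) : ZMod 2) :=
      fun c => by
        change (((exampleDiagram.leftHalf c).ncard - 1 : ℕ) : ZMod 2) = _
        rw [exampleDiagram_leftHalf]
        exact congrArg (fun n : ℕ => ((n - 1 : ℕ) : ZMod 2)) (Set.ncard_coe_finset (exampleHalf c))
    refine (h 0).trans (Eq.trans ?_ (h 2).symm)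
    decide
  · intro h
    -- the parity can be computed with the trivial chain
    have h1 := fun g => (BasedMatrix.IsExt.refl _).reducedParity_eq
      (.refl (exampleDiagram.basedMatrix (ZMod 2))) (F exampleDiagram rfl) hprim.1 g
    have h2 := (h1 (some (0 : Fin 3))).symm.trans (Eq.trans h (h1 (some (2 : Fin 3))))
    obtain ⟨n, hn⟩ := AddSubgroup.mem_zmultiples_iff.1 (QuotientAddGroup.eq.1 h2)
    have h3 := congrFun hn exampleClass
    have h4 : ∀ g, (exampleDiagram.basedMatrix (ZMod 2)).reducedValue g exampleClass.1 =
        exampleB g (some 1) := fun g => by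
      rw [BasedMatrix.reducedValue, exampleClass_val, BasedMatrix.rowSum_singleton,
        Set.ncard_singleton, show 1 / 2 = 0 from rfl, zero_smul, sub_zero]
      exact exampleDiagram_b _ _
    have h5 : (exampleDiagram.basedMatrix (ZMod 2)).barS exampleClass = 0 := by
      rw [BasedMatrix.barS, exampleClass_val, BasedMatrix.rowSum_singleton]
      exact (exampleDiagram_b _ _).trans (by decide)
    rw [Pi.smul_apply, h5, smul_zero] at h3
    have h6 : (0 : ZMod 2) = -exampleB (some 0) (some 1) + exampleB (some 2) (some 1) :=
      h3.trans (congrArg₂ (fun a b => -a + b) (h4 (some (0 : Fin 3))) (h4 (some (2 : Fin 3))))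
    exact absurd h6 (by decide)

end KnotParity

end

theorem mainTheorem7 :
    (∀ (R : Type*) [CommRing R] (κ : KnotParity.KnotKind) (K : KnotParity.Knot κ),
      -- the primitive based matrix of the knot, and the coefficient group, exist and are unique
      (∃ T : KnotParity.BasedMatrix R, KnotParity.IsPrimitiveMatrixOf K T) ∧
      (∀ T T' : KnotParity.BasedMatrix R,
        KnotParity.IsPrimitiveMatrixOf K T → KnotParity.IsPrimitiveMatrixOf K T' →
        Nonempty (KnotParity.BasedMatrix.Iso T T') ∧ Nonempty (T.CoeffGroup ≃+ T'.CoeffGroup)) ∧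
      ∀ T : KnotParity.BasedMatrix R, KnotParity.IsPrimitiveMatrixOf K T →
        -- every diagram of the knot gives a based matrix homologous to `T`; a chain identifies
        -- the coefficient groups, and the reduced stable parity does not depend on the chains
        Nonempty (KnotParity.ChainSystem K T) ∧
        (∀ (F : KnotParity.ChainSystem K T) (D : KnotParity.Diagram κ) (hD : D.IsDiagramOf K),
          (fun C => (D.basedMatrix R).rowSum (D.basedMatrix R).s ((F D hD).lift C.1)) = T.barS) ∧
        (∀ F F' : KnotParity.ChainSystem K T,
          KnotParity.reducedStableParity F = KnotParity.reducedStableParity F') ∧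
        -- it is a parity
        ∀ F : KnotParity.ChainSystem K T,
          KnotParity.IsOrientedParity K (KnotParity.reducedStableParity F) ∧
          ((2 : R) = 0 → KnotParity.IsParity K (KnotParity.reducedStableParity F))) ∧
    -- it is not determined by the Gaussian parity
    (∃ (K : KnotParity.Knot .virtual) (T : KnotParity.BasedMatrix (ZMod 2))
      (F : KnotParity.ChainSystem K T) (D : KnotParity.Diagram .virtual) (hD : D.IsDiagramOf K)
      (c c' : D.V), KnotParity.IsPrimitiveMatrixOf K T ∧
        D.gaussianParity c = D.gaussianParity c' ∧
        KnotParity.reducedStableParity F D hD c ≠ KnotParity.reducedStableParity F D hD c') := by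
  refine ⟨fun R _ κ K => ⟨KnotParity.exists_isPrimitiveMatrixOf K, fun T T' h h' => ?_,
    fun T hT => ⟨hT.nonempty_chainSystem, fun F D hD => funext fun C => ?_, fun F F' => ?_,
      fun F => ⟨KnotParity.isOrientedParity_reducedStableParity hT.1 F,
        KnotParity.isParity_reducedStableParity hT.1 F⟩⟩⟩, KnotParity.exists_not_gaussian⟩
  · obtain ⟨e⟩ := h.nonempty_iso h'
    exact ⟨⟨e⟩, e.nonempty_coeffGroup⟩
  · exact (F D hD).rowSum_s D.basedMatrix_b_s C.isSat
  · funext D hD c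
    exact (KnotParity.BasedMatrix.IsExt.refl _).reducedParity_eq _ _ hT.1 _
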